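/- Let $\mu$ be a nontrivial measure on $\mathbb{R}$ (all moments finite, support infinite), let $\{P_n\}_{n\ge 0}$ be its monic orthogonal polynomials, and let $\{a_n\}_{n\ge 1}$, $\{b_n\}_{n\ge 1}$ ($a_n>0$, $b_n\in\mathbb{R}$) be its Jacobi parameters, defined by $$xP_n(x) = P_{n+1}(x) + b_{n+1}P_n(x) + a_n^2 P_{n-1}(x)\quad (n\ge 0),\qquad P_0=1,\ P_{-1}=0.$$ Assume $$\sum_{n=1}^\infty n\bigl(|a_n-1|+|b_n|\bigr)<\infty .$$ Then $\mu$ has only finitely many mass points (points $E$ with $\mu(\{E\})>0$) outside $[-2,2]$; let $J<\infty$ be their number. For all sufficiently large $n$, $P_n$ has precisely $J$ zeros outside $[-2,2]$ and the other $n-J$ zeros, all distinct, in $[-2,2]$. Moreover, for all sufficiently large $n$ there are $0<\theta_1^{(n)}<\cdots<\theta_{n-J}^{(n)}<\pi$ such that the zeros of $P_n$ in $[-2,2]$ are exactly the points $2\cos\theta_\ell^{(n)}$, $\ell=1,\dots,n-J$, and $$\sup_{j=1,\dots,n-J-1} n\left|\theta_{j+1}^{(n)}-\theta_j^{(n)}-\frac{2\pi}{2n}\right|\longrightarrow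 0\qquad (n\to\infty).$$ -/

import Mathlib

open MeasureTheory Polynomial Filter Topology

namespace OPRL

/-- A nontrivial measure on the real line: all moments are finite (in particular the total mass is)
and the measure is not supported on a finite set. -/
structure IsNontrivial (μ : Measure ℝ) : Prop where
  integrable_pow : ∀ n : ℕ, Integrable (fun x : ℝ => x ^ n) μ
  infinite_support : μ.support.Infinite

/-- `P` is the sequence of monic orthogonal polynomials of `μ`. -/
structure IsMonicOrthogonal (μ : Measure ℝ) (P : ℕ → ℝ[X]) : Prop where
  monic : ∀ n, (P n).Monic
  natDegree_eq : ∀ n, (P n).natDegree = n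
  orthogonal : ∀ m n, m ≠ n → ∫ x, (P m).eval x * (P n).eval x ∂μ = 0

/-- `a 1, a 2, …` and `b 1, b 2, …` are the Jacobi parameters of the monic orthogonal polynomials
`P`: `a n > 0` and `x P_n = P_{n+1} + b_{n+1} P_n + a_n ^ 2 P_{n-1}`, with `P_{-1} = 0`.
The values `a 0` and `b 0` play no role. -/
structure IsJacobiParameters (P : ℕ → ℝ[X]) (a b : ℕ → ℝ) : Prop where
  a_pos : ∀ n, 1 ≤ n → 0 < a n
  recursion_zero : X * P 0 = P 1 + C (b 1) * P 0
  recursion : ∀ n, 1 ≤ n →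
    X * P n = P (n + 1) + C (b (n + 1)) * P n + C (a n ^ 2) * P (n - 1)

/-- The mass points of `μ` which lie outside `[-2, 2]`. -/
def massPointsOutside (μ : Measure ℝ) : Set ℝ :=
  {E | E ∉ Set.Icc (-2 : ℝ) 2 ∧ μ {E} ≠ 0}

/-- The number `J` of mass points outside `[-2, 2]` (meaningful when there are finitely many). -/
noncomputable def massPointCount (μ : Measure ℝ) : ℕ := (massPointsOutside μ).ncard

/-- The zeros of `p` in `[-2, 2]`. -/
def zerosInside (p : ℝ[X]) : Set ℝ := {x | p.IsRoot x ∧ x ∈ Set.Icc (-2 : ℝ) 2}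

/-- The real zeros of `p` outside `[-2, 2]`. -/
def zerosOutside (p : ℝ[X]) : Set ℝ := {x | p.IsRoot x ∧ x ∉ Set.Icc (-2 : ℝ) 2}

end OPRL

namespace OPRL

/-! The weight `n` in the hypothesis is what controls the band edges `±2`, where the free recursion
has a double characteristic root. At energy 2 the recursion is a second-difference equation whose
coefficients have a finite first moment, so it has a positive solution `Q` tending to 1 with ratios
`ρ n = Q (n+1) / Q n` satisfying `∑ |ρ n - 1| < ∞` (`exists_jost_ratio`).

Spacing. Put `h n = P (n+1) - ρ n * P n` and, for `x = 2 cos θ`, `F n θ = h n + (1 - e^{-iθ}) P n`.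
In the free case `F (n+1) = e^{iθ} F n` exactly. In general the relative error is summable uniformly
down to `θ = 0` (`norm_jost_step_le`), because `ρ` absorbs the edge behaviour. Since `Im F n = sin θ
* P n`, zeros of `P n` are the angles where `F n` is real. At scale `1/n` the function looks like `R
e^{iu}` with `u = n (t - θ)`, so neighbouring zeros are `π/n + o(1/n)` apart (`eventually_spacing`).
The left half of the band follows by the reflection `x ↦ -x`.

Counting. The same solution shows that `P n` eventually keeps its sign at 2, so Sturm interlacing
bounds the number of zeros above 2, and by reflection below -2. Gauss quadrature shows that every
support point is a limit of zeros, so the support outside `[-2, 2]` is finite and consists of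
isolated atoms. An orthogonality argument bounds the outside zeros by the number of these atoms, and
the limits of zeros give the converse for large `n`. -/

/-! ### Nearly rotating sequences and the spacing of their real points. -/

lemma norm_sub_le_of_relative_step {V : ℕ → ℂ} {ε : ℕ → ℝ} {M : ℕ} (hε : ∀ n, 0 ≤ ε n)
    (hτ : ∀ k, ∑ i ∈ Finset.range k, ε (M + i) ≤ 1 / 2)
    (h : ∀ n ≥ M, ‖V (n + 1) - V n‖ ≤ ε n * ‖V n‖) (k : ℕ) :
    ‖V (M + k) - V M‖ ≤ 2 * (∑ i ∈ Finset.range k, ε (M + i)) * ‖V M‖ := by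
  induction k with
  | zero => simp
  | succ k ih =>
    rw [Finset.sum_range_succ]
    have h1 := h (M + k) (by omega)
    have h2 : ‖V (M + k)‖ ≤ 2 * ‖V M‖ := by
      have h3 := norm_le_norm_add_norm_sub (V M) (V (M + k))
      rw [norm_sub_rev] at h3
      have := mul_le_mul_of_nonneg_right (hτ k) (norm_nonneg (V M))
      linarith
    have h4 : ‖V (M + (k + 1)) - V M‖ ≤ ‖V (M + k + 1) - V (M + k)‖ + ‖V (M + k) - V M‖ := by
      have := norm_add_le (V (M + k + 1) - V (M + k)) (V (M + k) - V M)
      simpa [add_assoc] using this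
    have := mul_le_mul_of_nonneg_left h2 (hε (M + k))
    linarith

lemma exists_tail_sum_le {ε : ℕ → ℝ} (hε : ∀ n, 0 ≤ ε n) (hs : Summable ε) {η : ℝ} (hη : 0 < η)
    (N : ℕ) : ∃ M ≥ N, ∀ k, ∑ i ∈ Finset.range k, ε (M + i) ≤ η := by
  have h1 := (tendsto_sum_nat_add ε).eventually (gt_mem_nhds hη)
  obtain ⟨M, hM, hN⟩ := (h1.and (eventually_ge_atTop N)).exists
  refine ⟨M, hN, fun k => ?_⟩
  have h2 : Summable fun i => ε (M + i) := by
    simpa [add_comm] using (summable_nat_add_iff M).2 hs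
  have h3 := h2.sum_le_tsum (Finset.range k) (fun i _ => hε _)
  have h4 : ∑' i, ε (M + i) = ∑' i, ε (i + M) := by simp [add_comm]
  linarith

/-- Sequences that nearly rotate by the angle `θ` in each step have almost constant phase (after
the rotation is removed) at the scale `1 / n`, uniformly in `θ`. -/
lemma eventually_rotation_ratio {F : ℕ → ℝ → ℂ} {ε : ℕ → ℝ} {N : ℕ} {β : ℝ} (hε : ∀ n, 0 ≤ ε n)
    (hs : Summable ε) (hF : ∀ n ≥ N, ContinuousOn (F n) (Set.Icc 0 β))
    (hF0 : ∀ n ≥ N, ∀ θ ∈ Set.Icc 0 β, F n θ ≠ 0)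
    (hstep : ∀ n ≥ N, ∀ θ ∈ Set.Ioc 0 β,
      ‖F (n + 1) θ - Complex.exp (θ * Complex.I) * F n θ‖ ≤ ε n * ‖F n θ‖)
    {η C : ℝ} (hη : 0 < η) :
    ∀ᶠ n : ℕ in atTop, ∀ θ ∈ Set.Ioc 0 β, ∀ t ∈ Set.Ioc 0 β, |t - θ| ≤ C / n →
      ‖Complex.exp (-(n * (t - θ) : ℝ) * Complex.I) * F n t - F n θ‖ ≤ η * ‖F n θ‖ := by
  -- The 8 is the loss along `H n t`, `H M t`, `H M θ`, `H n θ`: the three errors total at most `4 *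
  -- η₁ * ‖H M θ‖`, and `‖H M θ‖ ≤ 2 * ‖H n θ‖`.
  set η₁ : ℝ := min (η / 8) (1 / 4) with hη₁
  have hη₁0 : 0 < η₁ := by positivity
  have hη₁8 : η₁ ≤ η / 8 := min_le_left _ _
  have hη₁4 : η₁ ≤ 1 / 4 := min_le_right _ _
  obtain ⟨M, hMN, hM⟩ := exists_tail_sum_le hε hs (η := η₁ / 2) (by positivity) N
  set H : ℕ → ℝ → ℂ := fun n θ => Complex.exp (-(n * θ : ℝ) * Complex.I) * F n θ with hH
  have hHn : ∀ n θ, ‖H n θ‖ = ‖F n θ‖ := by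
    intro n θ
    have : ‖Complex.exp (-(n * θ : ℝ) * Complex.I)‖ = 1 := by
      rw [← Complex.ofReal_neg, Complex.norm_exp_ofReal_mul_I]
    simp only [hH, norm_mul, this, one_mul]
  have hHstep : ∀ n ≥ N, ∀ θ ∈ Set.Ioc 0 β, ‖H (n + 1) θ - H n θ‖ ≤ ε n * ‖H n θ‖ := by
    intro n hn θ hθ
    have h1 : H (n + 1) θ - H n θ = Complex.exp (-((n + 1 : ℕ) * θ : ℝ) * Complex.I) *
        (F (n + 1) θ - Complex.exp (θ * Complex.I) * F n θ) := by
      simp only [hH, mul_sub, ← mul_assoc, ← Complex.exp_add]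
      congr 3
      push_cast; ring_nf
    have : ‖Complex.exp (-((n + 1 : ℕ) * θ : ℝ) * Complex.I)‖ = 1 := by
      rw [← Complex.ofReal_neg, Complex.norm_exp_ofReal_mul_I]
    rw [h1, norm_mul, this, one_mul, hHn]
    exact hstep n hn θ hθ
  have hclose : ∀ n ≥ M, ∀ θ ∈ Set.Ioc 0 β, ‖H n θ - H M θ‖ ≤ η₁ * ‖H M θ‖ := by
    intro n hn θ hθ
    obtain ⟨k, rfl⟩ := Nat.exists_eq_add_of_le hn
    have h1 := norm_sub_le_of_relative_step (V := fun n => H n θ) hε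
      (fun k => (hM k).trans (by linarith)) (fun n hn => hHstep n (hMN.trans hn) θ hθ) k
    refine h1.trans (mul_le_mul_of_nonneg_right ?_ (norm_nonneg _))
    linarith [hM k]
  have hHc : ContinuousOn (H M) (Set.Icc 0 β) :=
    ContinuousOn.mul (by fun_prop) (hF M hMN)
  -- Nonvanishing at 0 is essential here: compactness of the closed interval is what makes the
  -- estimate uniform near the band edge.
  obtain ⟨c, hc, hcH⟩ : ∃ c > 0, ∀ θ ∈ Set.Icc 0 β, c ≤ ‖H M θ‖ := by
    rcases (Set.Icc 0 β).eq_empty_or_nonempty with he | hne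
    · exact ⟨1, one_pos, by simp [he]⟩
    · obtain ⟨x, hx, hmin⟩ := isCompact_Icc.exists_isMinOn hne hHc.norm
      refine ⟨‖H M x‖, ?_, fun θ hθ => hmin hθ⟩
      rw [hHn]; exact norm_pos_iff.2 (hF0 M hMN x hx)
  have huc := isCompact_Icc.uniformContinuousOn_of_continuous hHc
  obtain ⟨δ, hδ, hδH⟩ := Metric.uniformContinuousOn_iff.1 huc (η₁ * c) (by positivity)
  have hlim : Tendsto (fun n : ℕ => C / (n : ℝ)) atTop (𝓝 0) :=
    tendsto_const_div_atTop_nhds_zero_nat C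
  filter_upwards [eventually_ge_atTop M, hlim.eventually (gt_mem_nhds hδ)]
    with n hnM hnδ θ hθ t ht htθ
  have e1 := hclose n hnM θ hθ
  have e2 := hclose n hnM t ht
  have e3 : ‖H M t - H M θ‖ ≤ η₁ * ‖H M θ‖ := by
    have h1 := hδH t ⟨ht.1.le, ht.2⟩ θ ⟨hθ.1.le, hθ.2⟩ (by rw [Real.dist_eq]; linarith)
    rw [dist_eq_norm] at h1
    exact h1.le.trans (mul_le_mul_of_nonneg_left (hcH θ ⟨hθ.1.le, hθ.2⟩) hη₁0.le)
  have e4 : ‖H M t‖ ≤ 2 * ‖H M θ‖ := by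
    have := norm_le_norm_add_norm_sub (H M θ) (H M t)
    rw [norm_sub_rev] at this
    nlinarith [norm_nonneg (H M θ)]
  have e5 : ‖H M θ‖ ≤ 2 * ‖H n θ‖ := by
    have h1 := norm_le_norm_add_norm_sub (H n θ) (H M θ)
    nlinarith [norm_nonneg (H M θ)]
  have e6 : ‖H n t - H n θ‖ ≤ 8 * η₁ * ‖H n θ‖ := by
    have h1 : H n t - H n θ = (H n t - H M t) + (H M t - H M θ) - (H n θ - H M θ) := by ring
    have h2 := norm_sub_le ((H n t - H M t) + (H M t - H M θ)) (H n θ - H M θ)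
    have h3 := norm_add_le (H n t - H M t) (H M t - H M θ)
    rw [h1]
    nlinarith [mul_le_mul_of_nonneg_left e4 hη₁0.le, mul_le_mul_of_nonneg_left e5 hη₁0.le]
  have h1 : Complex.exp (-(n * (t - θ) : ℝ) * Complex.I) * F n t - F n θ =
      Complex.exp ((n * θ : ℝ) * Complex.I) * (H n t - H n θ) := by
    simp only [hH, mul_sub, ← mul_assoc, ← Complex.exp_add]
    congr 1
    · congr 2; push_cast; ring
    · rw [← add_mul]; simp
  rw [h1, norm_mul, Complex.norm_exp_ofReal_mul_I, one_mul, ← hHn]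
  exact e6.trans (mul_le_mul_of_nonneg_right (by linarith) (norm_nonneg _))

/-- Consecutive zeros of the imaginary part of a nearly rotating sequence are asymptotically
equally spaced. -/
lemma eventually_spacing {F : ℕ → ℝ → ℂ} {ε : ℕ → ℝ} {N : ℕ} {α β : ℝ} (hαβ : α < β)
    (hε : ∀ n, 0 ≤ ε n)
    (hs : Summable ε) (hF : ∀ n ≥ N, ContinuousOn (F n) (Set.Icc 0 β))
    (hF0 : ∀ n ≥ N, ∀ θ ∈ Set.Icc 0 β, F n θ ≠ 0)
    (hstep : ∀ n ≥ N, ∀ θ ∈ Set.Ioc 0 β,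
      ‖F (n + 1) θ - Complex.exp (θ * Complex.I) * F n θ‖ ≤ ε n * ‖F n θ‖)
    {Z : ℕ → Set ℝ} (hZpos : ∀ n, ∀ θ ∈ Z n, 0 < θ)
    (hZ : ∀ n ≥ N, ∀ θ ∈ Set.Ioc 0 β, θ ∈ Z n ↔ (F n θ).im = 0)
    (halt : ∀ n ≥ N, ∀ θ ∈ Z n, ∀ t ∈ Z n, θ < t → t ≤ β → (∀ u ∈ Set.Ioo θ t, u ∉ Z n) →
      (F n θ).re * (F n t).re < 0)
    {κ : ℝ} (hκ : 0 < κ) :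
    ∀ᶠ n : ℕ in atTop, ∀ θ ∈ Z n, θ ≤ α → ∀ t ∈ Z n, θ < t →
      (∀ u ∈ Set.Ioo θ t, u ∉ Z n) → |n * (t - θ) - Real.pi| ≤ κ := by
  wlog hκ1 : κ ≤ 1 generalizing κ
  · filter_upwards [this one_pos le_rfl] with n hn θ hθ hα t ht hlt hu
    exact (hn θ hθ hα t ht hlt hu).trans (not_le.1 hκ1).le
  have hπ := Real.pi_gt_three
  -- Being below `sin κ`, this error cannot change the sign of the imaginary part at the local
  -- phases `π - κ` and `π + κ`, so a zero lies between them.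
  set η : ℝ := Real.sin κ / 2 with hη
  have hsin : 0 < Real.sin κ := Real.sin_pos_of_pos_of_lt_pi hκ (by linarith)
  have hη0 : 0 < η := by positivity
  have hη2 : η ≤ 1 / 2 := by have := Real.sin_le_one κ; simp only [hη]; linarith
  have hlim : Tendsto (fun n : ℕ => (Real.pi + κ) / (n : ℝ)) atTop (𝓝 0) :=
    tendsto_const_div_atTop_nhds_zero_nat _
  filter_upwards [eventually_rotation_ratio hε hs hF hF0 hstep (C := Real.pi + κ) hη0,
    eventually_ge_atTop N, eventually_gt_atTop 0, hlim.eventually (gt_mem_nhds (sub_pos.2 hαβ))]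
    with n hratio hnN hn0 hnw θ hθ hθα t ht hlt hnone
  have hn : (0 : ℝ) < n := by exact_mod_cast hn0
  have hθ0 := hZpos n θ hθ
  have hθI : θ ∈ Set.Ioc 0 β := ⟨hθ0, by linarith⟩
  have him := (hZ n hnN θ hθI).1 hθ
  have hR : F n θ = ((F n θ).re : ℂ) := by
    apply Complex.ext <;> simp [him]
  set R := (F n θ).re with hRdef
  have hR0 : R ≠ 0 := by
    intro h0; rw [h0] at hR; exact hF0 n hnN θ ⟨hθ0.le, hθI.2⟩ (by simpa using hR)
  -- local form of the function
  have hloc : ∀ u : ℝ, 0 ≤ u → u ≤ Real.pi + κ → θ + u / n ∈ Set.Ioc 0 β ∧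
      |(F n (θ + u / n)).im / R - Real.sin u| ≤ η ∧
      |(F n (θ + u / n)).re / R - Real.cos u| ≤ η := by
    intro u hu0 hu
    have hun : u / n ≤ (Real.pi + κ) / n := by gcongr
    have hun0 : 0 ≤ u / n := by positivity
    have hI : θ + u / n ∈ Set.Ioc 0 β := ⟨by linarith, by linarith⟩
    refine ⟨hI, ?_⟩
    have h1 := hratio θ hθI _ hI (by rw [add_sub_cancel_left, abs_of_nonneg hun0]; exact hun)
    rw [add_sub_cancel_left, mul_div_cancel₀ u hn.ne'] at h1
    set G := F n (θ + u / n) with hG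
    have h2 : ‖G / R - Complex.exp (u * Complex.I)‖ ≤ η := by
      have h3 : G / R - Complex.exp (u * Complex.I) = Complex.exp (u * Complex.I) / R *
          (Complex.exp (-(u : ℝ) * Complex.I) * G - F n θ) := by
        rw [hR]
        have h4 : Complex.exp (u * Complex.I) * Complex.exp (-(u : ℝ) * Complex.I) = 1 := by
          rw [← Complex.exp_add]; simp
        have hRC : (R : ℂ) ≠ 0 := by exact_mod_cast hR0
        rw [div_mul_eq_mul_div, mul_sub, ← mul_assoc, h4, one_mul, sub_div, mul_div_cancel_right₀ _ hRC]
      rw [h3, norm_mul, norm_div, Complex.norm_exp_ofReal_mul_I]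
      rw [hR] at h1
      have hRn : 0 < ‖(R : ℂ)‖ := by simpa using hR0
      rw [div_mul_eq_mul_div, one_mul, div_le_iff₀ hRn]
      rwa [hR]
    have him' : (G / R - Complex.exp (u * Complex.I)).im = G.im / R - Real.sin u := by
      rw [Complex.sub_im, Complex.div_ofReal_im, Complex.exp_ofReal_mul_I_im]
    have hre' : (G / R - Complex.exp (u * Complex.I)).re = G.re / R - Real.cos u := by
      rw [Complex.sub_re, Complex.div_ofReal_re, Complex.exp_ofReal_mul_I_re]
    exact ⟨him' ▸ (Complex.abs_im_le_norm _).trans h2, hre' ▸ (Complex.abs_re_le_norm _).trans h2⟩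
  have hu : t = θ + (n * (t - θ)) / n := by field_simp; ring
  set u := n * (t - θ) with hudef
  have hu0 : 0 < u := mul_pos hn (by linarith)
  have hupper : u ≤ Real.pi + κ := by
    by_contra hcon
    push Not at hcon
    have hc : ContinuousOn (fun v : ℝ => (F n (θ + v / n)).im / R)
        (Set.Icc (Real.pi - κ) (Real.pi + κ)) := by
      refine ContinuousOn.div_const (Complex.continuous_im.comp_continuousOn
        ((hF n hnN).comp (by fun_prop) ?_)) _
      intro v hv
      have := (hloc v (by linarith [hv.1]) hv.2).1
      exact ⟨this.1.le, this.2⟩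
    have hA := (abs_le.1 (hloc (Real.pi - κ) (by linarith) (by linarith)).2.1).1
    have hB := (abs_le.1 (hloc (Real.pi + κ) (by linarith) (by linarith)).2.1).2
    rw [Real.sin_pi_sub] at hA
    rw [add_comm Real.pi κ, Real.sin_add_pi, add_comm κ] at hB
    obtain ⟨v, hv, hv0⟩ := intermediate_value_Icc' (by linarith : Real.pi - κ ≤ Real.pi + κ) hc
      (show (0 : ℝ) ∈ Set.Icc _ _ from ⟨by linarith, by linarith⟩)
    have hvZ : θ + v / n ∈ Z n := by
      refine (hZ n hnN _ (hloc v (by linarith [hv.1]) hv.2).1).2 ?_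
      simpa [hR0] using hv0
    refine hnone _ ⟨?_, ?_⟩ hvZ
    · have : 0 < v / n := div_pos (by linarith [hv.1]) hn
      linarith
    · rw [hu]
      have : v / n < u / n := by gcongr; linarith [hv.2]
      linarith
  rw [abs_le]
  refine ⟨?_, by linarith⟩
  by_contra hcon
  push Not at hcon
  have hlow : u < Real.pi - κ := by linarith
  obtain ⟨hI, hs1, hs2⟩ := hloc u hu0.le hupper
  rw [← hu] at hI hs1 hs2
  -- A real point with phase below `π - κ` and sine at most `η` would have phase near 0, hence
  -- cosine near 1. The alternation of signs rules this out.
  have hreneg : (F n t).re / R < 0 := by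
    have := halt n hnN θ hθ t ht hlt hI.2 hnone
    rw [← hRdef] at this
    rcases mul_neg_iff.1 this with h | h
    · exact div_neg_of_neg_of_pos h.2 h.1
    · exact div_neg_of_pos_of_neg h.2 h.1
  rw [(hZ n hnN t hI).1 ht] at hs1
  have hsu : 0 < Real.sin u := Real.sin_pos_of_pos_of_lt_pi hu0 (by linarith)
  have hsu' : Real.sin u ≤ η := by
    rw [zero_div, zero_sub, abs_neg, abs_of_pos hsu] at hs1; exact hs1
  have hcu : Real.cos u ≤ η := by linarith [(abs_le.1 hs2).1]
  rcases le_or_gt u (Real.pi / 2) with h | h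
  · have hc0 : 0 ≤ Real.cos u := Real.cos_nonneg_of_mem_Icc ⟨by linarith, h⟩
    nlinarith [Real.sin_sq_add_cos_sq u]
  · have : Real.sin κ < Real.sin u := by
      rw [← Real.sin_pi_sub u]
      exact Real.sin_lt_sin_of_lt_of_le_pi_div_two (by linarith) (by linarith) (by linarith)
    linarith

/-! ### The subordinate solution at the band edge. -/

lemma tsum_weighted_tail_sub {r : ℕ → ℝ} (hr : Summable fun j : ℕ => ((j : ℝ) + 1) * |r j|) :
    (∀ n, Summable fun j : ℕ => ((j : ℝ) + 1) * r (n + j)) ∧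
    (∀ n, Summable fun j : ℕ => r (n + j)) ∧
    (∀ n, ∑' j : ℕ, ((j : ℝ) + 1) * r (n + j) - ∑' j : ℕ, ((j : ℝ) + 1) * r (n + 1 + j) =
      ∑' j : ℕ, r (n + j)) ∧
    (∀ n, ∑' j : ℕ, r (n + j) - ∑' j : ℕ, r (n + 1 + j) = r n) := by
  have h1 : ∀ n, Summable fun j : ℕ => ((j : ℝ) + 1) * r (n + j) := by
    intro n
    have h2 := (summable_nat_add_iff n).2 hr
    refine Summable.of_norm_bounded h2 fun j => ?_
    rw [norm_mul, Real.norm_eq_abs, Real.norm_eq_abs, abs_of_nonneg (by positivity), add_comm n j]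
    gcongr
    linarith
  have h2 : ∀ n, Summable fun j : ℕ => r (n + j) := by
    intro n
    refine Summable.of_norm_bounded (h1 n).norm fun j => ?_
    rw [norm_mul, Real.norm_eq_abs ((j : ℝ) + 1), abs_of_nonneg (by positivity)]
    nlinarith [norm_nonneg (r (n + j)), (Nat.cast_nonneg j : (0 : ℝ) ≤ j)]
  refine ⟨h1, h2, fun n => ?_, fun n => ?_⟩
  · have h3 : Summable fun j : ℕ => (j : ℝ) * r (n + j) := by
      simpa [add_mul] using (h1 n).sub (h2 n)
    have h4 : ∑' j : ℕ, ((j : ℝ) + 1) * r (n + 1 + j) = ∑' j : ℕ, (j : ℝ) * r (n + j) := by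
      rw [h3.tsum_eq_zero_add]
      simp only [Nat.cast_zero, zero_mul, zero_add, Nat.cast_add, Nat.cast_one]
      exact tsum_congr fun j => by rw [add_assoc, add_comm 1 j]
    rw [h4, ← (h1 n).tsum_sub h3]
    exact tsum_congr fun j => by ring
  · rw [(h2 n).tsum_eq_zero_add]
    have : ∑' j : ℕ, r (n + (j + 1)) = ∑' j : ℕ, r (n + 1 + j) :=
      tsum_congr fun j => by rw [add_assoc, add_comm 1 j]
    rw [this]; simp

/-- Tail sums of `|r|` are successive differences of weighted tails, so their partial sums telescope
and stay below the first moment. -/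
lemma summable_tail_sums {r : ℕ → ℝ} (hr : Summable fun j : ℕ => ((j : ℝ) + 1) * |r j|) :
    Summable fun n : ℕ => |∑' j : ℕ, r (n + j)| := by
  obtain ⟨h1, h2, h3, -⟩ := tsum_weighted_tail_sub (r := fun j => |r j|) (by simpa using hr)
  have h5 : Summable fun n : ℕ => ∑' j : ℕ, |r (n + j)| := by
    refine summable_of_sum_range_le (c := ∑' j : ℕ, ((j : ℝ) + 1) * |r (0 + j)|)
      (fun n => tsum_nonneg fun j => abs_nonneg _) fun K => ?_
    have h6 : ∑ n ∈ Finset.range K, ∑' j : ℕ, |r (n + j)| =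
        ∑' j : ℕ, ((j : ℝ) + 1) * |r (0 + j)| - ∑' j : ℕ, ((j : ℝ) + 1) * |r (K + j)| := by
      induction K with
      | zero => simp
      | succ K ih => rw [Finset.sum_range_succ, ih, ← h3 K]; ring
    rw [h6]
    have : 0 ≤ ∑' j : ℕ, ((j : ℝ) + 1) * |r (K + j)| := tsum_nonneg fun j => by positivity
    linarith
  refine Summable.of_nonneg_of_le (fun _ => abs_nonneg _) (fun n => ?_) h5
  have := norm_tsum_le_tsum_norm (f := fun j => r (n + j)) (h2 n)
  simpa using this

/-- A second-order difference equation with small first moments of its coefficients has a solution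
that is close to `1` and of bounded variation. -/
lemma exists_near_one_solution {α β : ℕ → ℝ}
    (hs : ∑' n : ℕ, ((n : ℝ) + 1) * (|β n| + |α n|) ≤ 1 / 3)
    (hsum : Summable fun n : ℕ => ((n : ℝ) + 1) * (|β n| + |α n|)) :
    ∃ f : ℕ → ℝ, (∀ n, 1 / 2 ≤ f n) ∧
      (∀ n, f (n + 2) - 2 * f (n + 1) + f n = β n * f (n + 1) + α n * f n) ∧
      Summable fun n => |f (n + 1) - f n| := by
  let r : (ℕ → ℝ) → ℕ → ℝ := fun f k => β k * f (k + 1) + α k * f k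
  have hr : ∀ (f : ℕ → ℝ) (C : ℝ), (∀ n, |f n| ≤ C) → ∀ k, |r f k| ≤ (|β k| + |α k|) * C := by
    intro f C hf k
    calc |r f k| ≤ |β k * f (k + 1)| + |α k * f k| := abs_add_le _ _
      _ ≤ |β k| * C + |α k| * C := by
        rw [abs_mul, abs_mul]; gcongr <;> apply hf
      _ = _ := by ring
  have hrs : ∀ (f : ℕ → ℝ) (C : ℝ), (∀ n, |f n| ≤ C) →
      Summable fun j : ℕ => ((j : ℝ) + 1) * |r f j| := by
    intro f C hf
    refine Summable.of_nonneg_of_le (fun j => by positivity) (fun j => ?_) (hsum.mul_right C)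
    rw [mul_assoc]; gcongr; exact hr f C hf j
  have hbound : ∀ (f : ℕ → ℝ) (C : ℝ), (∀ n, |f n| ≤ C) → ∀ n,
      |∑' j : ℕ, ((j : ℝ) + 1) * r f (n + j)| ≤ C / 3 := by
    intro f C hf n
    have hC : 0 ≤ C := (abs_nonneg _).trans (hf 0)
    have hsn := (summable_nat_add_iff n).2 hsum
    have h1 : ‖∑' j : ℕ, ((j : ℝ) + 1) * r f (n + j)‖ ≤
        ∑' j : ℕ, (((j + n : ℕ) : ℝ) + 1) * (|β (j + n)| + |α (j + n)|) * C := by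
      refine tsum_of_norm_bounded (hsn.mul_right C).hasSum fun j => ?_
      rw [norm_mul, Real.norm_eq_abs, Real.norm_eq_abs, abs_of_nonneg (by positivity),
        add_comm n j, mul_assoc]
      gcongr
      · linarith
      · exact hr f C hf _
    rw [tsum_mul_right] at h1
    have h2 := hsum.sum_add_tsum_nat_add n
    have h3 : 0 ≤ ∑ i ∈ Finset.range n, ((i : ℝ) + 1) * (|β i| + |α i|) :=
      Finset.sum_nonneg fun i _ => by positivity
    calc _ ≤ _ := h1
      _ ≤ 1 / 3 * C := by gcongr; linarith
      _ = C / 3 := by ring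
  have hfb : ∀ (f : BoundedContinuousFunction ℕ ℝ) n, |f n| ≤ ‖f‖ := fun f n => f.norm_coe_le_norm n
  -- Summing the equation twice from infinity, with limit 1 there, gives this fixed-point problem.
  -- The first-moment bound `1 / 3` makes it a contraction; it also yields `‖f‖ ≤ 3 / 2`, hence `|f
  -- n - 1| ≤ 1 / 2`.
  let T : BoundedContinuousFunction ℕ ℝ → BoundedContinuousFunction ℕ ℝ := fun f =>
    BoundedContinuousFunction.ofNormedAddCommGroupDiscrete
      (fun n => 1 + ∑' j : ℕ, ((j : ℝ) + 1) * r f (n + j)) (1 + ‖f‖ / 3) fun n => by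
        refine (norm_add_le _ _).trans ?_
        rw [norm_one]
        have := hbound f ‖f‖ (hfb f) n
        rw [Real.norm_eq_abs]; linarith
  have hT : ∀ f n, T f n = 1 + ∑' j : ℕ, ((j : ℝ) + 1) * r f (n + j) := fun f n => rfl
  have hcontr : ContractingWith (1 / 3) T := by
    refine ⟨by norm_num, LipschitzWith.of_dist_le_mul fun f g => ?_⟩
    rw [BoundedContinuousFunction.dist_le (by positivity)]
    intro n
    have hfg : ∀ m, |(fun m => f m - g m) m| ≤ dist f g := fun m => by
      have := f.dist_coe_le_dist (g := g) m
      rwa [Real.dist_eq] at this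
    have h1 := hbound (fun m => f m - g m) _ hfg n
    have h2 : T f n - T g n = ∑' j : ℕ, ((j : ℝ) + 1) * r (fun m => f m - g m) (n + j) := by
      rw [hT, hT, add_sub_add_left_eq_sub,
        ← ((tsum_weighted_tail_sub (hrs f _ (hfb f))).1 n).tsum_sub
          ((tsum_weighted_tail_sub (hrs g _ (hfb g))).1 n)]
      exact tsum_congr fun j => by simp only [r]; ring
    rw [Real.dist_eq, h2]
    refine h1.trans (le_of_eq ?_)
    push_cast; ring
  have hfix := hcontr.fixedPoint_isFixedPt
  set f := hcontr.fixedPoint T with hf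
  have hfe : ∀ n, f n = 1 + ∑' j : ℕ, ((j : ℝ) + 1) * r f (n + j) := fun n => by
    rw [← hT, hfix]
  have hnorm : ‖f‖ ≤ 3 / 2 := by
    have : ‖f‖ ≤ 1 + ‖f‖ / 3 := by
      rw [BoundedContinuousFunction.norm_le (by positivity)]
      intro n
      rw [hfe n]
      refine (norm_add_le _ _).trans ?_
      rw [norm_one]
      have := hbound f ‖f‖ (hfb f) n
      rw [Real.norm_eq_abs]; linarith
    linarith
  obtain ⟨-, -, h3, h4⟩ := tsum_weighted_tail_sub (hrs f _ (hfb f))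
  have hdiff : ∀ n, f (n + 1) - f n = -∑' j : ℕ, r f (n + j) := fun n => by
    rw [hfe n, hfe (n + 1), ← h3 n]; ring
  refine ⟨f, fun n => ?_, fun n => ?_, ?_⟩
  · have := hbound f ‖f‖ (hfb f) n
    rw [hfe n]
    linarith [(abs_le.1 this).1]
  · have e1 := hdiff n
    have e2 := hdiff (n + 1)
    have e3 := h4 n
    have e4 : r f n = β n * f (n + 1) + α n * f n := rfl
    rw [← e4]
    linarith
  · simp only [hdiff, abs_neg]
    exact summable_tail_sums (hrs f _ (hfb f))

/-- The ratios `ρ n` of a subordinate solution of the Jacobi recursion at the energy `2`. -/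
lemma exists_jost_ratio {a b : ℕ → ℝ}
    (hsum : Summable fun n : ℕ => (n : ℝ) * (|a n - 1| + |b n|)) :
    ∃ (N : ℕ) (Q ρ : ℕ → ℝ), (∀ n ≥ N, 0 < Q n) ∧ (∀ n ≥ N, 0 < ρ n) ∧
      (∀ n ≥ N, Q (n + 1) = ρ n * Q n) ∧
      (∀ n ≥ N, ρ (n + 1) + a (n + 1) ^ 2 / ρ n = 2 - b (n + 2)) ∧
      Summable (fun n => |ρ n - 1|) := by
  have ha : Summable fun n : ℕ => (n : ℝ) * |a n - 1| :=
    Summable.of_nonneg_of_le (fun n => by positivity)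
      (fun n => by gcongr; linarith [abs_nonneg (b n)]) hsum
  have hb : Summable fun n : ℕ => (n : ℝ) * |b n| :=
    Summable.of_nonneg_of_le (fun n => by positivity)
      (fun n => by gcongr; linarith [abs_nonneg (a n - 1)]) hsum
  have ha1 : ∀ n : ℕ, |1 - a (n + 1) ^ 2| ≤
      (2 + ∑' n : ℕ, (n : ℝ) * |a n - 1|) * |a (n + 1) - 1| := by
    intro n
    have h1 := ha.le_tsum (n + 1) (fun j _ => by positivity)
    have h2 : |a (n + 1) - 1| ≤ ((n + 1 : ℕ) : ℝ) * |a (n + 1) - 1| := by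
      push_cast
      nlinarith [abs_nonneg (a (n + 1) - 1), (Nat.cast_nonneg n : (0 : ℝ) ≤ n)]
    have h3 : |1 - a (n + 1) ^ 2| = |a (n + 1) - 1 + 2| * |a (n + 1) - 1| := by
      rw [← abs_mul, ← abs_neg]; congr 1; ring
    rw [h3]
    gcongr
    have := abs_add_le (a (n + 1) - 1) 2
    rw [abs_two] at this
    linarith
  have ha2 : Summable fun n : ℕ => ((n : ℝ) + 1) * |1 - a (n + 1) ^ 2| := by
    refine Summable.of_nonneg_of_le (fun n => by positivity) (fun n => ?_)
      (((summable_nat_add_iff 1).2 ha).mul_left (2 + ∑' n : ℕ, (n : ℝ) * |a n - 1|))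
    have := mul_le_mul_of_nonneg_left (ha1 n) (by positivity : (0 : ℝ) ≤ (n : ℝ) + 1)
    push_cast; linarith
  have hb2 : Summable fun n : ℕ => ((n : ℝ) + 1) * |-b (n + 2)| := by
    refine Summable.of_nonneg_of_le (fun n => by positivity) (fun n => ?_)
      ((summable_nat_add_iff 2).2 hb)
    rw [abs_neg]; push_cast
    gcongr; linarith
  have hε : Summable fun n : ℕ => ((n : ℝ) + 1) * (|-b (n + 2)| + |1 - a (n + 1) ^ 2|) := by
    simpa [mul_add] using hb2.add ha2
  -- At energy 2 the second difference of a solution has coefficients `-b (n+2)` and `1 - a (n+1) ^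
  -- 2`. Discarding `N` terms brings their first moment below `1 / 3`.
  obtain ⟨N, hN⟩ := ((tendsto_sum_nat_add
    fun n : ℕ => ((n : ℝ) + 1) * (|-b (n + 2)| + |1 - a (n + 1) ^ 2|)).eventually
      (gt_mem_nhds (by norm_num : (0 : ℝ) < 1 / 3))).exists
  have hle : ∀ n : ℕ, ((n : ℝ) + 1) * (|-b (n + N + 2)| + |1 - a (n + N + 1) ^ 2|) ≤
      (((n + N : ℕ) : ℝ) + 1) * (|-b (n + N + 2)| + |1 - a (n + N + 1) ^ 2|) := fun n => by
    push_cast; gcongr; linarith [(Nat.cast_nonneg N : (0 : ℝ) ≤ N)]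
  have hεN := (summable_nat_add_iff N).2 hε
  have hεN' := Summable.of_nonneg_of_le (fun n => by positivity) hle hεN
  obtain ⟨f, hf1, hf2, hf3⟩ := exists_near_one_solution
    (β := fun n => -b (n + N + 2)) (α := fun n => 1 - a (n + N + 1) ^ 2)
    ((hεN'.tsum_le_tsum hle hεN).trans hN.le) hεN'
  have hfpos : ∀ n, 0 < f n := fun n => lt_of_lt_of_le (by norm_num) (hf1 n)
  refine ⟨N, fun n => f (n - N), fun n => f (n - N + 1) / f (n - N), fun n _ => hfpos _,
    fun n _ => div_pos (hfpos _) (hfpos _), fun n hn => ?_, fun n hn => ?_, ?_⟩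
  · have : n + 1 - N = n - N + 1 := by omega
    simp only [this]
    field_simp [(hfpos (n - N)).ne']
  · obtain ⟨m, rfl⟩ := Nat.exists_eq_add_of_le' hn
    have e1 : m + N + 1 - N = m + 1 := by omega
    have h1 := (hfpos m).ne'
    have h2 := (hfpos (m + 1)).ne'
    have h3 := hf2 m
    simp only [e1, Nat.add_sub_cancel]
    field_simp
    linear_combination h3
  · rw [← summable_nat_add_iff N]
    refine Summable.of_nonneg_of_le (fun n => abs_nonneg _) (fun n => ?_) (hf3.mul_left 2)
    simp only [Nat.add_sub_cancel]
    have h1 := hfpos n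
    rw [div_sub_one h1.ne', abs_div, abs_of_pos h1, div_le_iff₀ h1]
    nlinarith [abs_nonneg (f (n + 1) - f n), hf1 n]

/-! ### Sign changes, interlacing and the zeros beyond 2. -/

lemma eval_mul_eval_pos_of_no_root {q : ℝ[X]} {u v : ℝ} (huv : u ≤ v)
    (h : ∀ x ∈ Set.Icc u v, q.eval x ≠ 0) : 0 < q.eval u * q.eval v := by
  by_contra hcon
  push Not at hcon
  have hc : ContinuousOn (fun x => q.eval x) (Set.Icc u v) := q.continuous.continuousOn
  have hu := h u ⟨le_rfl, huv⟩
  have hv := h v ⟨huv, le_rfl⟩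
  rcases lt_or_gt_of_ne hu with h1 | h1
  · have h2 : 0 < q.eval v := lt_of_le_of_ne (by nlinarith) hv.symm
    obtain ⟨x, hx, hx0⟩ := intermediate_value_Icc huv hc ⟨h1.le, h2.le⟩
    exact h x hx hx0
  · have h2 : q.eval v < 0 := lt_of_le_of_ne (by nlinarith) hv
    obtain ⟨x, hx, hx0⟩ := intermediate_value_Icc' huv hc ⟨h2.le, h1.le⟩
    exact h x hx hx0

lemma exists_root_Ioo_of_mul_neg {q : ℝ[X]} {u v : ℝ} (huv : u ≤ v)
    (h : q.eval u * q.eval v < 0) : ∃ x ∈ Set.Ioo u v, q.eval x = 0 := by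
  by_contra hcon
  push Not at hcon
  have hu : q.eval u ≠ 0 := fun h0 => by simp [h0] at h
  have hv : q.eval v ≠ 0 := fun h0 => by simp [h0] at h
  refine absurd (eval_mul_eval_pos_of_no_root huv fun x hx => ?_) (not_lt.2 h.le)
  rcases eq_or_lt_of_le hx.1 with h1 | h1
  · rwa [← h1]
  rcases eq_or_lt_of_le hx.2 with h2 | h2
  · rwa [h2]
  exact hcon x ⟨h1, h2⟩

/-- After dividing by `X - v`, the quotient has constant sign on `[y, v]` and its value at `v` is
the derivative of `p` there. -/
lemma eval_mul_derivative_neg {p : ℝ[X]} {y v : ℝ} (hyv : y < v) (hv : p.eval v = 0)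
    (hv' : p.derivative.eval v ≠ 0) (h : ∀ x ∈ Set.Ico y v, p.eval x ≠ 0) :
    p.eval y * p.derivative.eval v < 0 := by
  obtain ⟨q, rfl⟩ := dvd_iff_isRoot.2 hv
  have hd : (derivative ((X - C v) * q)).eval v = q.eval v := by simp
  rw [hd] at hv' ⊢
  have hpos : 0 < q.eval y * q.eval v := by
    refine eval_mul_eval_pos_of_no_root hyv.le fun x hx => ?_
    rcases eq_or_lt_of_le hx.2 with h2 | h2
    · rwa [h2]
    · intro h0
      exact h x ⟨hx.1, h2⟩ (by simp [h0])
  simp only [eval_mul, eval_sub, eval_X, eval_C]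
  nlinarith

/-- At consecutive zeros the derivatives have opposite signs. -/
lemma derivative_mul_derivative_neg {p : ℝ[X]} {u v : ℝ} (huv : u < v) (hu : p.eval u = 0)
    (hv : p.eval v = 0) (hu' : p.derivative.eval u ≠ 0) (hv' : p.derivative.eval v ≠ 0)
    (h : ∀ x ∈ Set.Ioo u v, p.eval x ≠ 0) :
    p.derivative.eval u * p.derivative.eval v < 0 := by
  obtain ⟨q, rfl⟩ := dvd_iff_isRoot.2 hu
  have hd : ∀ x, (derivative ((X - C u) * q)).eval x = q.eval x + (x - u) * q.derivative.eval x :=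
    fun x => by simp
  have hqv : q.eval v = 0 := by
    simpa [sub_ne_zero.2 huv.ne'] using hv
  rw [hd] at hu' hv' ⊢
  rw [hd v]
  rw [hqv] at hv' ⊢
  simp only [sub_self, zero_mul, add_zero, zero_add] at hu' hv' ⊢
  have h1 : q.derivative.eval v ≠ 0 := right_ne_zero_of_mul hv'
  have h2 := eval_mul_derivative_neg huv hqv h1 fun x hx => by
    rcases eq_or_lt_of_le hx.1 with h3 | h3
    · rwa [← h3]
    · intro h0
      exact h x ⟨h3, hx.2⟩ (by simp [h0])
  have := mul_neg_of_pos_of_neg (sub_pos.2 huv) h2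
  linarith

section Recursion

variable {P : ℕ → ℝ[X]} {a b : ℕ → ℝ}

lemma IsJacobiParameters.succ_succ (hab : IsJacobiParameters P a b) (n : ℕ) :
    P (n + 2) = (X - C (b (n + 2))) * P (n + 1) - C (a (n + 1) ^ 2) * P n := by
  have := hab.recursion (n + 1) (by omega)
  simp only [Nat.add_sub_cancel] at this
  linear_combination -this

lemma IsJacobiParameters.eval_succ_succ (hab : IsJacobiParameters P a b) (n : ℕ) (x : ℝ) :
    (P (n + 2)).eval x = (x - b (n + 2)) * (P (n + 1)).eval x - a (n + 1) ^ 2 * (P n).eval x := by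
  rw [hab.succ_succ]; simp

/-- Writing `W n` for this expression, the recursion gives `W (n+1) = P (n+1) ^ 2 + a (n+1) ^ 2 * W
n`. Simplicity of zeros and interlacing all come from this positivity. -/
lemma IsJacobiParameters.wronskian_pos (hab : IsJacobiParameters P a b) (h0 : P 0 = 1) (n : ℕ)
    (x : ℝ) : 0 < (P (n + 1)).derivative.eval x * (P n).eval x -
      (P n).derivative.eval x * (P (n + 1)).eval x := by
  induction n with
  | zero =>
    have h1 : P 1 = X - C (b 1) := by
      have := hab.recursion_zero
      rw [h0] at this
      linear_combination -this
    simp [h0, h1]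
  | succ n ih =>
    have ha := pow_pos (hab.a_pos (n + 1) (by omega)) 2
    have h1 : (P (n + 2)).derivative.eval x = (P (n + 1)).eval x +
        (x - b (n + 2)) * (P (n + 1)).derivative.eval x -
          a (n + 1) ^ 2 * (P n).derivative.eval x := by
      rw [hab.succ_succ, derivative_sub, derivative_mul, derivative_C_mul]; simp
    rw [h1, hab.eval_succ_succ]
    have := mul_pos ha ih
    nlinarith [sq_nonneg ((P (n + 1)).eval x)]

lemma IsJacobiParameters.derivative_ne_zero (hab : IsJacobiParameters P a b) (h0 : P 0 = 1) {n : ℕ}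
    {x : ℝ} (hx : (P n).eval x = 0) : (P n).derivative.eval x ≠ 0 := by
  intro h
  have := hab.wronskian_pos h0 n x
  simp [hx, h] at this

lemma IsJacobiParameters.not_both_zero (hab : IsJacobiParameters P a b) (h0 : P 0 = 1) {n : ℕ}
    {x : ℝ} (hx : (P n).eval x = 0) : (P (n + 1)).eval x ≠ 0 := by
  intro h
  have := hab.wronskian_pos h0 n x
  simp [hx, h] at this

lemma IsJacobiParameters.ne_zero (hab : IsJacobiParameters P a b) (h0 : P 0 = 1) (n : ℕ) :
    P n ≠ 0 := by
  intro h
  have := hab.derivative_ne_zero h0 (n := n) (x := 0) (by simp [h])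
  simp [h] at this

/-- Between `2` and a zero `x > 2` of `P (n + 1)` there is a zero of `P n` which is not separated
from `x` by zeros of `P (n + 1)`. -/
lemma IsJacobiParameters.exists_preceding_root (hab : IsJacobiParameters P a b) (h0 : P 0 = 1)
    {n : ℕ} (h2 : 0 < (P n).eval 2 * (P (n + 1)).eval 2) {x : ℝ} (hx2 : 2 < x)
    (hx : (P (n + 1)).eval x = 0) :
    ∃ t, 2 < t ∧ t < x ∧ (P n).eval t = 0 ∧ ∀ y ∈ Set.Ico t x, (P (n + 1)).eval y ≠ 0 := by
  classical
  have hx' := hab.derivative_ne_zero h0 hx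
  have hWx := hab.wronskian_pos h0 n x
  rw [hx, mul_zero, sub_zero] at hWx
  set R : Finset ℝ := (P (n + 1)).roots.toFinset.filter fun y => 2 < y ∧ y < x with hR
  have hmem : ∀ y, y ∈ R ↔ (P (n + 1)).eval y = 0 ∧ 2 < y ∧ y < x := fun y => by
    simp [hR, hab.ne_zero h0]
  have h20 : (P (n + 1)).eval 2 ≠ 0 := fun h => by simp [h] at h2
  rcases R.eq_empty_or_nonempty with he | hne
  · have hno : ∀ y ∈ Set.Ico 2 x, (P (n + 1)).eval y ≠ 0 := by
      intro y hy hy0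
      rcases eq_or_lt_of_le hy.1 with h | h
      · exact h20 (h ▸ hy0)
      · have := (hmem y).2 ⟨hy0, h, hy.2⟩
        simp [he] at this
    have h3 := eval_mul_derivative_neg hx2 hx hx' hno
    have h4 : (P n).eval 2 * (P n).eval x < 0 := by
      have e1 := mul_neg_of_pos_of_neg (mul_pos h2 hWx) h3
      -- The product of the known signs is a square times the wanted product, so the sign can be
      -- read off.
      have e2 : (P n).eval 2 * (P (n + 1)).eval 2 * ((P (n + 1)).derivative.eval x * (P n).eval x) *
        ((P (n + 1)).eval 2 * (P (n + 1)).derivative.eval x) =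
        ((P (n + 1)).eval 2 * (P (n + 1)).derivative.eval x) ^ 2 *
          ((P n).eval 2 * (P n).eval x) := by ring
      rw [e2] at e1
      exact neg_of_mul_neg_right e1 (sq_nonneg _)
    obtain ⟨t, ht, ht0⟩ := exists_root_Ioo_of_mul_neg hx2.le h4
    exact ⟨t, ht.1, ht.2, ht0, fun y hy => hno y ⟨ht.1.le.trans hy.1, hy.2⟩⟩
  · set u := R.max' hne with hu
    obtain ⟨hu0, hu2, hux⟩ := (hmem u).1 (R.max'_mem hne)
    have hno : ∀ y ∈ Set.Ioo u x, (P (n + 1)).eval y ≠ 0 := by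
      intro y hy hy0
      have := R.le_max' y ((hmem y).2 ⟨hy0, hu2.trans hy.1, hy.2⟩)
      exact absurd hy.1 (not_lt.2 this)
    have hu' := hab.derivative_ne_zero h0 hu0
    have hWu := hab.wronskian_pos h0 n u
    rw [hu0, mul_zero, sub_zero] at hWu
    have h3 := derivative_mul_derivative_neg hux hu0 hx hu' hx' hno
    have h4 : (P n).eval u * (P n).eval x < 0 := by
      have e1 := mul_neg_of_pos_of_neg (mul_pos hWu hWx) h3
      have e2 : (P (n + 1)).derivative.eval u * (P n).eval u *
          ((P (n + 1)).derivative.eval x * (P n).eval x) *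
        ((P (n + 1)).derivative.eval u * (P (n + 1)).derivative.eval x) =
        ((P (n + 1)).derivative.eval u * (P (n + 1)).derivative.eval x) ^ 2 *
          ((P n).eval u * (P n).eval x) := by ring
      rw [e2] at e1
      exact neg_of_mul_neg_right e1 (sq_nonneg _)
    obtain ⟨t, ht, ht0⟩ := exists_root_Ioo_of_mul_neg hux.le h4
    exact ⟨t, hu2.trans ht.1, ht.2, ht0, fun y hy => hno y ⟨ht.1.trans_le hy.1, hy.2⟩⟩

/-- The zeros of `p` in `(2, ∞)`. -/
def rootsAbove (p : ℝ[X]) : Set ℝ := {x | p.IsRoot x ∧ 2 < x}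

lemma finite_rootsAbove {p : ℝ[X]} (hp : p ≠ 0) : (rootsAbove p).Finite :=
  (finite_setOfPred_isRoot hp).subset fun _ hx => hx.1

/-- The preceding zeros of `P n` lie in disjoint gaps between zeros of `P (n + 1)`, so choosing them
is injective. -/
lemma IsJacobiParameters.ncard_rootsAbove_succ_le (hab : IsJacobiParameters P a b) (h0 : P 0 = 1)
    {n : ℕ} (h2 : 0 < (P n).eval 2 * (P (n + 1)).eval 2) :
    (rootsAbove (P (n + 1))).ncard ≤ (rootsAbove (P n)).ncard := by
  have h : ∀ x ∈ rootsAbove (P (n + 1)), ∃ t, 2 < t ∧ t < x ∧ (P n).eval t = 0 ∧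
      ∀ y ∈ Set.Ico t x, (P (n + 1)).eval y ≠ 0 :=
    fun x hx => hab.exists_preceding_root h0 h2 hx.2 hx.1
  choose! f hf using h
  refine Set.ncard_le_ncard_of_injOn f (fun x hx => ⟨(hf x hx).2.2.1, (hf x hx).1⟩) ?_
    (finite_rootsAbove (hab.ne_zero h0 n))
  have hlt : ∀ x ∈ rootsAbove (P (n + 1)), ∀ y ∈ rootsAbove (P (n + 1)), x < y → f x ≠ f y := by
    intro x hx y hy hxy he
    have h1 := (hf x hx).2.1
    exact (hf y hy).2.2.2 x ⟨he ▸ h1.le, hxy⟩ hx.1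
  intro x hx y hy he
  rcases lt_trichotomy x y with h | h | h
  · exact absurd he (hlt x hx y hy h)
  · exact h
  · exact absurd he.symm (hlt y hy x hx h)

/-- The Riccati equation for `ρ` factors the recursion at energy 2 into two first-order steps; `x -
2` measures the departure from that energy. -/
lemma IsJacobiParameters.jost_step (hab : IsJacobiParameters P a b) {ρ : ℕ → ℝ} {n : ℕ}
    (hρ : 0 < ρ n) (hric : ρ (n + 1) + a (n + 1) ^ 2 / ρ n = 2 - b (n + 2)) (x : ℝ) :
    (P (n + 2)).eval x - ρ (n + 1) * (P (n + 1)).eval x =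
      (2 - b (n + 2) - ρ (n + 1)) * ((P (n + 1)).eval x - ρ n * (P n).eval x) +
        (x - 2) * (P (n + 1)).eval x := by
  rw [hab.eval_succ_succ]
  have h1 : ρ (n + 1) = 2 - b (n + 2) - a (n + 1) ^ 2 / ρ n := by linarith
  rw [h1]
  field_simp
  ring

/-- At the energy `2` the polynomials eventually keep their sign. -/
lemma IsJacobiParameters.eventually_eval_two_mul_pos (hab : IsJacobiParameters P a b)
    (h0 : P 0 = 1) (hsum : Summable fun n : ℕ => (n : ℝ) * (|a n - 1| + |b n|)) :
    ∀ᶠ n : ℕ in atTop, 0 < (P n).eval 2 * (P (n + 1)).eval 2 := by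
  obtain ⟨N, Q, ρ, hQ, hρ, hQρ, hric, -⟩ := exists_jost_ratio hsum
  set h : ℕ → ℝ := fun n => (P (n + 1)).eval 2 - ρ n * (P n).eval 2 with hh
  have hstep : ∀ n ≥ N, h (n + 1) = (a (n + 1) ^ 2 / ρ n) * h n := by
    intro n hn
    have := hab.jost_step (hρ n hn) (hric n hn) 2
    simp only [hh]
    rw [this, ← hric n hn]; ring
  have hσ : ∀ n ≥ N, 0 < a (n + 1) ^ 2 / ρ n := fun n hn =>
    div_pos (pow_pos (hab.a_pos (n + 1) (by omega)) 2) (hρ n hn)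
  -- If `h N = 0`, the values at 2 are a multiple of the positive solution. Otherwise `h` keeps its
  -- sign, so the quotient of `h N * P n(2)` by `Q n` is strictly increasing and eventually has one
  -- sign.
  rcases eq_or_ne (h N) 0 with hN | hN
  · have hall : ∀ n ≥ N, h n = 0 := by
      intro n hn
      induction n, hn using Nat.le_induction with
      | base => exact hN
      | succ n hn ih => rw [hstep n hn, ih, mul_zero]
    filter_upwards [eventually_ge_atTop N] with n hn
    have h1 : (P (n + 1)).eval 2 = ρ n * (P n).eval 2 := by linarith [hall n hn]
    have h2 : (P n).eval 2 ≠ 0 := fun h2 =>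
      hab.not_both_zero h0 h2 (by rw [h1, h2, mul_zero])
    rw [h1]
    have := mul_pos (hρ n hn) (pow_two_pos_of_ne_zero h2)
    nlinarith
  · have hall : ∀ n ≥ N, 0 < h N * h n := by
      intro n hn
      induction n, hn using Nat.le_induction with
      | base => exact mul_self_pos.2 hN
      | succ n hn ih =>
        rw [hstep n hn]
        have := mul_pos (hσ n hn) ih
        linarith
    set z : ℕ → ℝ := fun n => h N * (P n).eval 2 / Q n with hz
    have hzstep : ∀ n ≥ N, z n < z (n + 1) := by
      intro n hn
      have hQn := hQ n hn
      have hQn1 := hQ (n + 1) (by omega)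
      have e : z (n + 1) - z n = h N * h n / Q (n + 1) := by
        simp only [hz, hh]
        rw [hQρ n hn]
        have := (hρ n hn).ne'
        field_simp
      have := div_pos (hall n hn) hQn1
      linarith
    have hzmono : ∀ m ≥ N, ∀ n ≥ m, z m ≤ z n := by
      intro m hm n hn
      induction n, hn using Nat.le_induction with
      | base => exact le_rfl
      | succ n hn ih => exact ih.trans (hzstep n (hm.trans hn)).le
    have hconv : ∀ n ≥ N, 0 < z n * z (n + 1) → 0 < (P n).eval 2 * (P (n + 1)).eval 2 := by
      intro n hn hp
      have e : z n * z (n + 1) = h N ^ 2 * ((P n).eval 2 * (P (n + 1)).eval 2) /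
          (Q n * Q (n + 1)) := by
        simp only [hz]; ring
      rw [e, div_pos_iff_of_pos_right (mul_pos (hQ n hn) (hQ (n + 1) (by omega)))] at hp
      exact pos_of_mul_pos_right hp (sq_nonneg _)
    by_cases hex : ∃ m ≥ N, 0 ≤ z m
    · obtain ⟨m, hm, hzm⟩ := hex
      filter_upwards [eventually_ge_atTop (m + 1)] with n hn
      have hpos : ∀ k ≥ m + 1, 0 < z k := fun k hk =>
        lt_of_lt_of_le (lt_of_le_of_lt hzm (hzstep m hm)) (hzmono (m + 1) (by omega) k hk)
      exact hconv n (by omega) (mul_pos (hpos n hn) (hpos (n + 1) (by omega)))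
    · push Not at hex
      filter_upwards [eventually_ge_atTop N] with n hn
      exact hconv n hn (mul_pos_of_neg_of_neg (hex n hn) (hex (n + 1) (by omega)))

lemma IsJacobiParameters.exists_ncard_rootsAbove_le (hab : IsJacobiParameters P a b)
    (h0 : P 0 = 1) (hsum : Summable fun n : ℕ => (n : ℝ) * (|a n - 1| + |b n|)) :
    ∃ K, ∀ᶠ n : ℕ in atTop, (rootsAbove (P n)).ncard ≤ K := by
  obtain ⟨N, hN⟩ := eventually_atTop.1 (hab.eventually_eval_two_mul_pos h0 hsum)
  refine ⟨(rootsAbove (P N)).ncard, eventually_atTop.2 ⟨N, fun n hn => ?_⟩⟩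
  induction n, hn using Nat.le_induction with
  | base => exact le_rfl
  | succ n hn ih => exact (hab.ncard_rootsAbove_succ_le h0 (hN n hn)).trans ih

end Recursion

/-! ### Perturbed rotations for orthogonal polynomials. -/

/-- The angles `θ ∈ (0, π)` for which `2 cos θ` is a zero of `p`. -/
def zeroAngles (p : ℝ[X]) : Set ℝ :=
  {θ | θ ∈ Set.Ioo 0 Real.pi ∧ p.eval (2 * Real.cos θ) = 0}

lemma im_add_one_sub_exp_mul (h p θ : ℝ) :
    ((h : ℂ) + (1 - Complex.exp (-θ * Complex.I)) * p).im = Real.sin θ * p := by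
  have : Complex.exp (-θ * Complex.I) = Real.cos θ - Real.sin θ * Complex.I := by
    rw [← Complex.ofReal_neg, Complex.exp_mul_I, ← Complex.ofReal_cos, ← Complex.ofReal_sin,
      Real.cos_neg, Real.sin_neg]
    push_cast; ring
  rw [this]; simp [-Complex.ofReal_cos, -Complex.ofReal_sin]

/-- One step of the recursion, in the variables relative to a subordinate solution, is a rotation
by `θ` up to an error that is small uniformly for `θ` near `0`. -/
lemma norm_jost_step_le {h p h' p' σ ρ θ : ℝ} (hθ : θ ∈ Set.Ioc 0 (2 * Real.pi / 3))
    (hp' : p' = ρ * p + h) (hh' : h' = σ * h + (2 * Real.cos θ - 2) * p') :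
    ‖((h' : ℂ) + (1 - Complex.exp (-θ * Complex.I)) * p') - Complex.exp (θ * Complex.I) *
      ((h : ℂ) + (1 - Complex.exp (-θ * Complex.I)) * p)‖ ≤
      (3 * |σ - 1| + 2 * |ρ - 1|) * ‖(h : ℂ) + (1 - Complex.exp (-θ * Complex.I)) * p‖ := by
  have hπ := Real.pi_pos
  set z := Complex.exp (θ * Complex.I) with hz
  set w := Complex.exp (-θ * Complex.I) with hw
  have hzw : z * w = 1 := by rw [hz, hw, ← Complex.exp_add]; simp
  have hcos : (2 * Real.cos θ : ℂ) = z + w := by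
    rw [hz, hw, Complex.ofReal_cos, Complex.cos]; ring
  set F := (h : ℂ) + (1 - w) * p with hF
  -- The factor `z - 1` in front of `ρ - 1` is the crucial gain: `‖z - 1‖ * |p|` is bounded by `‖F‖`
  -- even as `θ → 0`, whereas `|p|` alone is not.
  have hexp : ((h' : ℂ) + (1 - w) * p') - z * F = (σ - 1) * h + (z - 1) * (ρ - 1) * p := by
    rw [hF, hh', hp']
    push_cast
    rw [← Complex.ofReal_cos, hcos]
    linear_combination (p : ℂ) * hzw
  have hs : ‖z - 1‖ = 2 * Real.sin (θ / 2) := by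
    have h1 := Complex.norm_exp_I_mul_ofReal_sub_one θ
    rw [mul_comm] at h1
    rw [hz, h1, Real.norm_eq_abs, abs_of_nonneg]
    exact mul_nonneg (by norm_num)
      (Real.sin_nonneg_of_nonneg_of_le_pi (by linarith [hθ.1]) (by linarith [hθ.2]))
  have hs' : ‖1 - w‖ = 2 * Real.sin (θ / 2) := by
    have h1 : 1 - w = w * (z - 1) := by linear_combination -hzw
    have h2 : ‖w‖ = 1 := by rw [hw, ← Complex.ofReal_neg, Complex.norm_exp_ofReal_mul_I]
    rw [h1, norm_mul, h2, one_mul, hs]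
  set s := 2 * Real.sin (θ / 2) with hsdef
  have hs0 : 0 ≤ s := hs ▸ norm_nonneg _
  -- This is where `θ ≤ 2π/3` enters: `sin θ = 2 sin (θ/2) cos (θ/2)` then controls `2 sin (θ/2)`.
  have hcos2 : 1 / 2 ≤ Real.cos (θ / 2) := by
    rw [← Real.cos_pi_div_three]
    exact Real.cos_le_cos_of_nonneg_of_le_pi (by linarith [hθ.1]) (by linarith)
      (by linarith [hθ.2])
  have hsp : s * |p| ≤ 2 * ‖F‖ := by
    have h1 := Complex.abs_im_le_norm F
    rw [hF, im_add_one_sub_exp_mul] at h1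
    have h2 : Real.sin θ = s * Real.cos (θ / 2) := by
      rw [hsdef, ← Real.sin_two_mul]; congr 1; ring
    rw [h2, abs_mul, abs_mul, abs_of_nonneg hs0, abs_of_nonneg (by linarith)] at h1
    nlinarith [mul_nonneg hs0 (abs_nonneg p)]
  have hh : |h| ≤ 3 * ‖F‖ := by
    have h1 : (h : ℂ) = F - (1 - w) * p := by rw [hF]; ring
    have h2 := norm_sub_le F ((1 - w) * p)
    rw [← h1, norm_mul, hs', Complex.norm_real, Complex.norm_real, Real.norm_eq_abs,
      Real.norm_eq_abs] at h2
    linarith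
  rw [hexp]
  have h1 : ‖((σ : ℂ) - 1) * h‖ = |σ - 1| * |h| := by
    rw [norm_mul, ← Complex.ofReal_one, ← Complex.ofReal_sub, Complex.norm_real, Complex.norm_real,
      Real.norm_eq_abs, Real.norm_eq_abs]
  have h2 : ‖(z - 1) * ((ρ : ℂ) - 1) * p‖ = |ρ - 1| * (s * |p|) := by
    rw [norm_mul, norm_mul, hs, ← Complex.ofReal_one, ← Complex.ofReal_sub, Complex.norm_real,
      Complex.norm_real, Real.norm_eq_abs, Real.norm_eq_abs]
    ring
  refine (norm_add_le _ _).trans ?_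
  rw [h1, h2]
  nlinarith [mul_le_mul_of_nonneg_left hh (abs_nonneg (σ - 1)),
    mul_le_mul_of_nonneg_left hsp (abs_nonneg (ρ - 1))]

section Recursion

variable {P : ℕ → ℝ[X]} {a b : ℕ → ℝ}

/-- By the Wronskian, `P (n + 1)` has the sign opposite to the derivative of `P n` at each zero of
`P n`. This supplies the alternation needed for the spacing, since the real part of `F n` at such a
zero is the value of `P (n + 1)`. -/
lemma IsJacobiParameters.eval_succ_mul_neg (hab : IsJacobiParameters P a b) (h0 : P 0 = 1)
    {n : ℕ} {u v : ℝ} (huv : u < v) (hu : (P n).eval u = 0) (hv : (P n).eval v = 0)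
    (h : ∀ x ∈ Set.Ioo u v, (P n).eval x ≠ 0) :
    (P (n + 1)).eval u * (P (n + 1)).eval v < 0 := by
  have h1 := derivative_mul_derivative_neg huv hu hv (hab.derivative_ne_zero h0 hu)
    (hab.derivative_ne_zero h0 hv) h
  have h2 := hab.wronskian_pos h0 n u
  have h3 := hab.wronskian_pos h0 n v
  rw [hu, mul_zero, zero_sub] at h2
  rw [hv, mul_zero, zero_sub] at h3
  have e1 := mul_neg_of_pos_of_neg (mul_pos h2 h3) h1
  have e2 : -((P n).derivative.eval u * (P (n + 1)).eval u) *
      -((P n).derivative.eval v * (P (n + 1)).eval v) *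
      ((P n).derivative.eval u * (P n).derivative.eval v) =
      ((P n).derivative.eval u * (P n).derivative.eval v) ^ 2 *
        ((P (n + 1)).eval u * (P (n + 1)).eval v) := by ring
  rw [e2] at e1
  exact neg_of_mul_neg_right e1 (sq_nonneg _)

/-- Asymptotically equal spacing of the zeros in the right half of `[-2, 2]`. -/
lemma IsJacobiParameters.eventually_spacing_right (hab : IsJacobiParameters P a b)
    (h0 : P 0 = 1) (hsum : Summable fun n : ℕ => (n : ℝ) * (|a n - 1| + |b n|))
    {κ : ℝ} (hκ : 0 < κ) :
    ∀ᶠ n : ℕ in atTop, ∀ θ ∈ zeroAngles (P n), θ ≤ Real.pi / 2 → ∀ t ∈ zeroAngles (P n), θ < t →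
      (∀ u ∈ Set.Ioo θ t, u ∉ zeroAngles (P n)) → |n * (t - θ) - Real.pi| ≤ κ := by
  have hπ := Real.pi_pos
  obtain ⟨N, Q, ρ, -, hρ, -, hric, hρs⟩ := exists_jost_ratio hsum
  set β := 2 * Real.pi / 3 with hβ
  set h : ℕ → ℝ[X] := fun n => P (n + 1) - C (ρ n) * P n with hh
  have hheval : ∀ n x, (h n).eval x = (P (n + 1)).eval x - ρ n * (P n).eval x := fun n x => by
    simp [hh]
  have hstep : ∀ n ≥ N, ∀ x, (h (n + 1)).eval x =
      (2 - b (n + 2) - ρ (n + 1)) * (h n).eval x + (x - 2) * (P (n + 1)).eval x := by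
    intro n hn x
    rw [hheval, hheval]
    exact hab.jost_step (hρ n hn) (hric n hn) x
  set F : ℕ → ℝ → ℂ := fun n θ => ((h n).eval (2 * Real.cos θ) : ℝ) +
    (1 - Complex.exp (-θ * Complex.I)) * ((P n).eval (2 * Real.cos θ) : ℝ) with hF
  set ε : ℕ → ℝ := fun n => 3 * |(2 - b (n + 2) - ρ (n + 1)) - 1| + 2 * |ρ n - 1| with hε
  have hε0 : ∀ n, 0 ≤ ε n := fun n => by positivity
  have hbs : Summable fun n => |b (n + 2)| := by
    refine Summable.of_nonneg_of_le (fun n => abs_nonneg _) (fun n => ?_)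
      ((summable_nat_add_iff 2).2 hsum)
    push_cast
    nlinarith [abs_nonneg (b (n + 2)), abs_nonneg (a (n + 2) - 1),
      (Nat.cast_nonneg n : (0 : ℝ) ≤ n)]
  have hεs : Summable ε := by
    refine Summable.add (Summable.mul_left 3 ?_) (hρs.mul_left 2)
    refine Summable.of_nonneg_of_le (fun n => abs_nonneg _) (fun n => ?_)
      (hbs.add ((summable_nat_add_iff 1).2 hρs))
    have := abs_add_le (-b (n + 2)) (-(ρ (n + 1) - 1))
    rw [abs_neg, abs_neg] at this
    refine le_trans (le_of_eq ?_) this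
    congr 1; ring
  have hFstep : ∀ n ≥ N, ∀ θ ∈ Set.Ioc 0 β,
      ‖F (n + 1) θ - Complex.exp (θ * Complex.I) * F n θ‖ ≤ ε n * ‖F n θ‖ := by
    intro n hn θ hθ
    exact norm_jost_step_le hθ (by rw [hheval]; ring) (hstep n hn _)
  have hFim : ∀ n θ, (F n θ).im = Real.sin θ * (P n).eval (2 * Real.cos θ) := fun n θ =>
    im_add_one_sub_exp_mul _ _ _
  have hsin : ∀ θ ∈ Set.Ioc 0 β, 0 < Real.sin θ := fun θ hθ =>
    Real.sin_pos_of_pos_of_lt_pi hθ.1 (by linarith [hθ.2])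
  have hFre : ∀ n θ, (P n).eval (2 * Real.cos θ) = 0 →
      (F n θ).re = (P (n + 1)).eval (2 * Real.cos θ) := fun n θ h1 => by
    simp only [hF, h1, hheval]; simp
  have hF0 : ∀ n, ∀ θ ∈ Set.Ioc 0 β, F n θ ≠ 0 := by
    intro n θ hθ hz
    have h1 := hFim n θ
    rw [hz, Complex.zero_im, eq_comm, mul_eq_zero] at h1
    have h2 := h1.resolve_left (hsin θ hθ).ne'
    have h3 := hFre n θ h2
    rw [hz, Complex.zero_re] at h3
    exact hab.not_both_zero h0 h2 h3.symm
  -- remove a possible zero of `F n` at `θ = 0`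
  obtain ⟨g, G, hg, hGc, hG0, hFG⟩ : ∃ (g : ℝ → ℝ) (G : ℕ → ℝ → ℂ), (∀ θ ∈ Set.Ioc 0 β, 0 < g θ) ∧
      (∀ n ≥ N, Continuous (G n)) ∧ (∀ n ≥ N, G n 0 ≠ 0) ∧
      ∀ n ≥ N, ∀ θ ∈ Set.Ioc 0 β, F n θ = g θ * G n θ := by
    have hstep2 : ∀ n ≥ N, (h (n + 1)).eval 2 = (2 - b (n + 2) - ρ (n + 1)) * (h n).eval 2 := by
      intro n hn
      rw [hstep n hn]; ring
    -- `F n 0` equals `(h n).eval 2`, which for `n ≥ N` vanishes always or never. If always, `2 sin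
    -- (θ/2)` divides out of both terms; being independent of `n`, it leaves the step estimate
    -- intact, and the quotient at 0 is `i * P n(2) ≠ 0`.
    rcases eq_or_ne ((h N).eval 2) 0 with hN | hN
    · have hall : ∀ n ≥ N, (h n).eval 2 = 0 := by
        intro n hn
        induction n, hn using Nat.le_induction with
        | base => exact hN
        | succ n hn ih => rw [hstep2 n hn, ih, mul_zero]
      have hdvd : ∀ n ≥ N, ∃ D : ℝ[X], h n = (X - C 2) * D := fun n hn =>
        dvd_iff_isRoot.2 (hall n hn)
      choose! D hD using hdvd
      refine ⟨fun θ => 2 * Real.sin (θ / 2), fun n θ =>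
        ((-(2 * Real.sin (θ / 2)) * (D n).eval (2 * Real.cos θ) : ℝ) : ℂ) +
          Complex.I * Complex.exp (-(θ / 2) * Complex.I) * ((P n).eval (2 * Real.cos θ) : ℝ),
        fun θ hθ => ?_, fun n hn => ?_, fun n hn => ?_, fun n hn θ hθ => ?_⟩
      · exact mul_pos two_pos (Real.sin_pos_of_pos_of_lt_pi (by linarith [hθ.1])
          (by linarith [hθ.2]))
      · have h1 : Continuous fun θ : ℝ => (D n).eval (2 * Real.cos θ) :=
          (D n).continuous.comp (by fun_prop)
        have h2 : Continuous fun θ : ℝ => (P n).eval (2 * Real.cos θ) :=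
          (P n).continuous.comp (by fun_prop)
        fun_prop
      · have h1 := hall n hn
        rw [hheval] at h1
        have h2 : (P n).eval 2 ≠ 0 := fun h2 =>
          hab.not_both_zero h0 h2 (by rw [h2] at h1; linarith)
        simpa using h2
      · simp only [hF, hD n hn]
        have hx : (2 * Real.cos θ - 2 : ℝ) = -(2 * Real.sin (θ / 2)) ^ 2 := by
          have h1 : θ = 2 * (θ / 2) := by ring
          rw [h1, Real.cos_two_mul, ← h1, mul_pow, Real.sin_sq]; ring
        have hw : 1 - Complex.exp (-θ * Complex.I) = (2 * Real.sin (θ / 2) : ℝ) *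
            (Complex.I * Complex.exp (-(θ / 2) * Complex.I)) := by
          have e1 : Complex.exp (-(θ / 2) * Complex.I) * Complex.exp (-(θ / 2) * Complex.I) =
              Complex.exp (-θ * Complex.I) := by
            rw [← Complex.exp_add]; congr 1; ring
          have e2 : Complex.exp (θ / 2 * Complex.I) * Complex.exp (-(θ / 2) * Complex.I) = 1 := by
            rw [← Complex.exp_add]; simp
          push_cast
          rw [Complex.sin]
          linear_combination e1 - e2 - (Complex.exp (-(θ / 2) * Complex.I) *
            Complex.exp (-(θ / 2) * Complex.I) - Complex.exp (θ / 2 * Complex.I) *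
            Complex.exp (-(θ / 2) * Complex.I)) * Complex.I_sq
        rw [hw, eval_mul, eval_sub, eval_X, eval_C, hx]
        push_cast
        ring
    · have hall : ∀ n ≥ N, (h n).eval 2 ≠ 0 := by
        intro n hn
        induction n, hn using Nat.le_induction with
        | base => exact hN
        | succ n hn ih =>
          rw [hstep2 n hn, ← hric n hn, add_sub_cancel_left]
          exact mul_ne_zero (div_pos (pow_pos (hab.a_pos (n + 1) (by omega)) 2) (hρ n hn)).ne' ih
      refine ⟨fun _ => 1, F, fun _ _ => one_pos, fun n _ => ?_, fun n hn => ?_, fun n _ θ _ => ?_⟩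
      · have h1 : Continuous fun θ : ℝ => (h n).eval (2 * Real.cos θ) :=
          (h n).continuous.comp (by fun_prop)
        have h2 : Continuous fun θ : ℝ => (P n).eval (2 * Real.cos θ) :=
          (P n).continuous.comp (by fun_prop)
        fun_prop
      · simpa [hF] using hall n hn
      · simp
  have hgC : ∀ θ ∈ Set.Ioc 0 β, (g θ : ℂ) ≠ 0 := fun θ hθ => by exact_mod_cast (hg θ hθ).ne'
  have hFGim : ∀ n ≥ N, ∀ θ ∈ Set.Ioc 0 β, (F n θ).im = g θ * (G n θ).im := fun n hn θ hθ => by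
    rw [hFG n hn θ hθ, Complex.im_ofReal_mul]
  have hFGre : ∀ n ≥ N, ∀ θ ∈ Set.Ioc 0 β, (F n θ).re = g θ * (G n θ).re := fun n hn θ hθ => by
    rw [hFG n hn θ hθ, Complex.re_ofReal_mul]
  refine eventually_spacing (F := G) (ε := ε) (N := N) (β := β) (by linarith) hε0 hεs
    (fun n hn => (hGc n hn).continuousOn) ?_ ?_ (fun n θ hθ => hθ.1.1) ?_ ?_ hκ
  · intro n hn θ hθ
    rcases eq_or_lt_of_le hθ.1 with h1 | h1
    · rw [← h1]; exact hG0 n hn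
    · intro h2
      exact hF0 n θ ⟨h1, hθ.2⟩ (by rw [hFG n hn θ ⟨h1, hθ.2⟩, h2, mul_zero])
  · intro n hn θ hθ
    have h1 := hFstep n hn θ hθ
    rw [hFG n hn θ hθ, hFG (n + 1) (by omega) θ hθ, mul_left_comm, ← mul_sub, norm_mul, norm_mul,
      mul_left_comm] at h1
    exact le_of_mul_le_mul_left h1 (norm_pos_iff.2 (hgC θ hθ))
  · intro n hn θ hθ
    have h1 := hFim n θ
    rw [hFGim n hn θ hθ] at h1
    constructor
    · intro hz
      rw [hz.2, mul_zero] at h1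
      exact (mul_eq_zero.1 h1).resolve_left (hg θ hθ).ne'
    · intro hz
      rw [hz, mul_zero, eq_comm] at h1
      exact ⟨⟨hθ.1, by linarith [hθ.2]⟩, (mul_eq_zero.1 h1).resolve_left (hsin θ hθ).ne'⟩
  · intro n hn θ hθ t ht hlt htβ hnone
    have hθI : θ ∈ Set.Ioc 0 β := ⟨hθ.1.1, by linarith⟩
    have htI : t ∈ Set.Ioc 0 β := ⟨ht.1.1, htβ⟩
    have hcos : 2 * Real.cos t < 2 * Real.cos θ := by
      have := Real.cos_lt_cos_of_nonneg_of_le_pi hθ.1.1.le ht.1.2.le hlt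
      linarith
    have h1 := hab.eval_succ_mul_neg h0 hcos ht.2 hθ.2 fun x hx hx0 => by
      have c1 := Real.neg_one_le_cos t
      have c2 := Real.cos_le_one θ
      have hxc : Real.cos (Real.arccos (x / 2)) = x / 2 :=
        Real.cos_arccos (by linarith [hx.1]) (by linarith [hx.2])
      have hu1 : θ < Real.arccos (x / 2) := by
        rw [← Real.arccos_cos hθ.1.1.le hθ.1.2.le]
        exact Real.arccos_lt_arccos (by linarith [hx.1]) (by linarith [hx.2]) c2
      have hu2 : Real.arccos (x / 2) < t := by
        rw [← Real.arccos_cos ht.1.1.le ht.1.2.le]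
        exact Real.arccos_lt_arccos c1 (by linarith [hx.1]) (by linarith [hx.2])
      refine hnone _ ⟨hu1, hu2⟩ ⟨⟨hθ.1.1.trans hu1, hu2.trans ht.1.2⟩, ?_⟩
      rw [hxc, mul_div_cancel₀ x two_ne_zero]; exact hx0
    rw [← hFre n t ht.2, ← hFre n θ hθ.2, hFGre n hn t htI, hFGre n hn θ hθI] at h1
    have e : g t * (G n t).re * (g θ * (G n θ).re) = (g t * g θ) * ((G n θ).re * (G n t).re) := by
      ring
    rw [e] at h1
    exact neg_of_mul_neg_right h1 (mul_pos (hg t htI) (hg θ hθI)).le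

end Recursion

/-! ### Bounded zeros, Gauss quadrature and the support. -/

section Bounds

variable {P : ℕ → ℝ[X]} {a b : ℕ → ℝ}

/-- The zeros of all polynomials lie in a bounded interval. -/
lemma IsJacobiParameters.exists_abs_root_le (hab : IsJacobiParameters P a b)
    (h0 : P 0 = 1) (hsum : Summable fun n : ℕ => (n : ℝ) * (|a n - 1| + |b n|)) :
    ∃ R > 0, ∀ n x, (P n).eval x = 0 → |x| ≤ R := by
  set S := ∑' n : ℕ, (n : ℝ) * (|a n - 1| + |b n|) with hS
  have hbd : ∀ n : ℕ, |a (n + 1) - 1| + |b (n + 1)| ≤ S := by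
    intro n
    have h1 := hsum.le_tsum (n + 1) (fun j _ => by positivity)
    refine le_trans ?_ h1
    push_cast
    nlinarith [abs_nonneg (a (n + 1) - 1), abs_nonneg (b (n + 1)),
      (Nat.cast_nonneg n : (0 : ℝ) ≤ n)]
  have hS0 : 0 ≤ S := (by positivity : 0 ≤ |a 1 - 1| + |b 1|).trans (hbd 0)
  refine ⟨S + (1 + S) ^ 2 + 1, by positivity, fun n x hx => ?_⟩
  by_contra hcon
  push Not at hcon
  -- For such large `|x|` the diagonal term dominates the recursion, so the absolute values never
  -- decrease from their initial value 1.
  have key : ∀ n, 0 < |(P n).eval x| ∧ |(P n).eval x| ≤ |(P (n + 1)).eval x| := by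
    intro n
    induction n with
    | zero =>
      have h1 : P 1 = X - C (b 1) := by
        have := hab.recursion_zero
        rw [h0] at this
        linear_combination -this
      have h2 := abs_sub_abs_le_abs_sub x (b 1)
      have h3 := hbd 0
      rw [zero_add] at h3
      simp only [h0, h1, zero_add, eval_one, eval_sub, eval_X, eval_C, abs_one]
      refine ⟨one_pos, ?_⟩
      nlinarith [abs_nonneg (a 1 - 1)]
    | succ n ih =>
      refine ⟨ih.1.trans_le ih.2, ?_⟩
      have h1 := hab.eval_succ_succ n x
      have h2 := abs_sub_abs_le_abs_sub ((x - b (n + 2)) * (P (n + 1)).eval x)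
        (a (n + 1) ^ 2 * (P n).eval x)
      rw [← h1, abs_mul, abs_mul, abs_of_nonneg (sq_nonneg (a (n + 1)))] at h2
      have h3 := abs_sub_abs_le_abs_sub x (b (n + 2))
      have h4 : a (n + 1) ^ 2 ≤ (1 + S) ^ 2 := by
        have e1 := hbd n
        have e2 := le_abs_self (a (n + 1) - 1)
        have e3 := hab.a_pos (n + 1) (by omega)
        have e4 := abs_nonneg (b (n + 1))
        gcongr
        linarith
      have h5 := hbd (n + 1)
      have h6 : 1 + (1 + S) ^ 2 ≤ |x - b (n + 2)| := by
        have := abs_nonneg (a (n + 1 + 1) - 1)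
        have h7 : |b (n + 2)| ≤ S := by
          have : |b (n + 1 + 1)| ≤ S := by linarith
          exact this
        linarith
      have h8 := mul_le_mul_of_nonneg_right h6 (abs_nonneg ((P (n + 1)).eval x))
      have h9 := mul_le_mul h4 ih.2 (abs_nonneg _) (by positivity)
      linarith
  have := (key n).1
  simp [hx] at this

end Bounds

section Measure

variable {μ : Measure ℝ} {P : ℕ → ℝ[X]}

lemma IsNontrivial.integrable_eval (hμ : IsNontrivial μ) (p : ℝ[X]) :
    Integrable (fun x => p.eval x) μ := by
  simp only [eval_eq_sum_range]
  exact integrable_finsetSum _ fun i _ => (hμ.integrable_pow i).const_mul _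

lemma IsNontrivial.isFiniteMeasure (hμ : IsNontrivial μ) : IsFiniteMeasure μ := by
  have := hμ.integrable_pow 0
  simp only [pow_zero] at this
  exact (integrable_const_iff_isFiniteMeasure one_ne_zero).1 this

/-- Such a polynomial vanishes almost everywhere, so its closed zero set contains the infinite
support. -/
lemma IsNontrivial.eq_zero_of_integral_eq_zero (hμ : IsNontrivial μ) {p : ℝ[X]}
    (hp : ∀ x ∈ μ.support, 0 ≤ p.eval x) (hzero : ∫ x, p.eval x ∂μ = 0) : p = 0 := by
  have hae : 0 ≤ᵐ[μ] fun x => p.eval x := by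
    filter_upwards [Measure.support_mem_ae (μ := μ)] with x hx using hp x hx
  have h1 := (integral_eq_zero_iff_of_nonneg_ae hae (hμ.integrable_eval p)).1 hzero
  by_contra hne
  refine hμ.infinite_support ((finite_setOfPred_isRoot hne).subset ?_)
  refine Measure.support_subset_of_isClosed (finite_setOfPred_isRoot hne).isClosed ?_
  filter_upwards [h1] with x hx using hx

lemma IsMonicOrthogonal.zero_eq_one (hP : IsMonicOrthogonal μ P) : P 0 = 1 :=
  eq_one_of_monic_natDegree_zero (hP.monic 0) (hP.natDegree_eq 0)

lemma IsMonicOrthogonal.integral_mul_eq_zero (hμ : IsNontrivial μ) (hP : IsMonicOrthogonal μ P)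
    {n : ℕ} {q : ℝ[X]} (hq : q.degree < n) : ∫ x, (P n * q).eval x ∂μ = 0 := by
  suffices h : ∀ k ≤ n, ∀ q : ℝ[X], q.degree < k → ∫ x, (P n * q).eval x ∂μ = 0 from
    h n le_rfl q hq
  intro k
  induction k with
  | zero =>
    intro _ q hq
    have : q = 0 := by
      rw [← degree_eq_bot]
      simpa using hq
    simp [this]
  | succ k ih =>
    intro hk q hq
    set q' := q - C (q.coeff k) * P k with hq'
    have hdeg : q'.degree < k := by
      rw [degree_lt_iff_coeff_zero]
      intro m hm
      rw [hq', coeff_sub, coeff_C_mul]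
      rcases eq_or_lt_of_le hm with h | h
      · have h1 : (P k).coeff k = 1 := by
          have := (hP.monic k).coeff_natDegree
          rwa [hP.natDegree_eq] at this
        rw [← h, h1]; ring
      · rw [coeff_eq_zero_of_degree_lt (hq.trans_le (by exact_mod_cast h)),
          coeff_eq_zero_of_natDegree_lt (p := P k) (by rw [hP.natDegree_eq]; exact h)]
        ring
    have h1 := ih (by omega) q' hdeg
    have h2 := hP.orthogonal n k (by omega)
    have h3 : ∀ x, (P n * q).eval x = (P n * q').eval x +
        q.coeff k * ((P n).eval x * (P k).eval x) := fun x => by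
      simp only [hq', eval_mul, eval_sub, eval_C]; ring
    have h4 : Integrable (fun x => (P n).eval x * (P k).eval x) μ := by
      simpa using hμ.integrable_eval (P n * P k)
    simp only [h3]
    rw [integral_add (hμ.integrable_eval _) (h4.const_mul _), h1, integral_const_mul, h2]
    ring

lemma IsMonicOrthogonal.nodup_roots {a b : ℕ → ℝ} (hP : IsMonicOrthogonal μ P)
    (hab : IsJacobiParameters P a b) (n : ℕ) : (P n).roots.Nodup := by
  classical
  rw [Multiset.nodup_iff_count_le_one]
  intro x
  rw [count_roots]
  by_contra hcon
  push Not at hcon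
  rw [one_lt_rootMultiplicity_iff_isRoot (hP.monic n).ne_zero] at hcon
  exact hab.derivative_ne_zero hP.zero_eq_one hcon.1 hcon.2

/-- Orthogonal polynomials have as many real zeros as their degree. -/
lemma IsMonicOrthogonal.card_roots (hμ : IsNontrivial μ)
    (hP : IsMonicOrthogonal μ P) (n : ℕ) : (P n).roots.card = n := by
  obtain ⟨q, hq, hcard, hq0⟩ := exists_prod_multiset_X_sub_C_mul (P n)
  rw [hP.natDegree_eq] at hcard
  by_contra hne
  have hlt : (P n).roots.card < n := by omega
  set pr := ((P n).roots.map fun a => X - C a).prod with hpr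
  have hqne : q ≠ 0 := by
    rintro rfl
    rw [mul_zero] at hq
    exact (hP.monic n).ne_zero hq.symm
  have hqx : ∀ x, q.eval x ≠ 0 := fun x hx => by
    have : x ∈ q.roots := (mem_roots hqne).2 hx
    simp [hq0] at this
  have hqpos : ∀ x, 0 < q.eval x * q.eval 0 := by
    intro x
    rcases le_total x 0 with h | h
    · exact eval_mul_eval_pos_of_no_root h fun y _ => hqx y
    · rw [mul_comm]; exact eval_mul_eval_pos_of_no_root h fun y _ => hqx y
  have hprdeg : pr.natDegree = (P n).roots.card := natDegree_multiset_prod_X_sub_C_eq_card _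
  have hprne : pr ≠ 0 := (monic_multiset_prod_of_monic _ _ fun a _ => monic_X_sub_C a).ne_zero
  -- If real zeros were missing, multiplying `P n` by this lower-degree polynomial would give `pr ^
  -- 2 * q * q(0) ≥ 0`, with zero integral.
  have hdeg : (C (q.eval 0) * pr).degree < n := by
    rw [degree_C_mul (hqx 0), degree_eq_natDegree hprne, hprdeg]
    exact_mod_cast hlt
  have hz := hμ.eq_zero_of_integral_eq_zero (fun x _ => ?_) (hP.integral_mul_eq_zero hμ hdeg)
  · exact mul_ne_zero (hP.monic n).ne_zero (mul_ne_zero (by simpa using hqx 0) hprne) hz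
  · rw [← hq]
    simp only [eval_mul, eval_C]
    have := mul_nonneg (sq_nonneg (pr.eval x)) (hqpos x).le
    nlinarith

lemma IsMonicOrthogonal.dvd_of_eval_eq_zero {a b : ℕ → ℝ} (hμ : IsNontrivial μ)
    (hP : IsMonicOrthogonal μ P) (hab : IsJacobiParameters P a b) {n : ℕ} {f : ℝ[X]}
    (hf : ∀ x, (P n).eval x = 0 → f.eval x = 0) : P n ∣ f := by
  rcases eq_or_ne f 0 with rfl | hf0
  · exact dvd_zero _
  have h1 := prod_multiset_X_sub_C_of_monic_of_roots_card_eq (hP.monic n)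
    (by rw [hP.card_roots hμ, hP.natDegree_eq])
  rw [← h1, Multiset.prod_X_sub_C_dvd_iff_le_roots hf0,
    Multiset.le_iff_subset (hP.nodup_roots hab n)]
  intro x hx
  exact (mem_roots hf0).2 (hf x ((mem_roots (hP.monic n).ne_zero).1 hx))

/-- Positivity of Gauss quadrature. -/
lemma IsMonicOrthogonal.integral_nonneg {a b : ℕ → ℝ} (hμ : IsNontrivial μ)
    (hP : IsMonicOrthogonal μ P) (hab : IsJacobiParameters P a b) {n : ℕ} {q : ℝ[X]}
    (hq : q.natDegree < 2 * n) (hpos : ∀ x, (P n).eval x = 0 → 0 ≤ q.eval x) :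
    0 ≤ ∫ x, q.eval x ∂μ := by
  classical
  set s := (P n).roots.toFinset with hs
  have hcard : s.card = n := by
    rw [hs, Multiset.toFinset_card_of_nodup (hP.nodup_roots hab n),
      hP.card_roots hμ]
  have hinj : Set.InjOn (id : ℝ → ℝ) s := Function.injective_id.injOn
  -- As `q - r ^ 2` vanishes at all nodes, it is `P n` times a polynomial of degree below `n`; hence
  -- `q` and `r ^ 2` have the same integral.
  set r := Lagrange.interpolate s id (fun x => √(q.eval x)) with hr
  have hrdeg : r.degree < n := hcard ▸ Lagrange.degree_interpolate_lt _ hinj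
  have hreval : ∀ x, (P n).eval x = 0 → r.eval x = √(q.eval x) := fun x hx =>
    Lagrange.eval_interpolate_at_node (v := id) _ hinj
      (by simp [hs, (hP.monic n).ne_zero, hx])
  obtain ⟨t, ht⟩ := hP.dvd_of_eval_eq_zero hμ hab (n := n) (f := q - r ^ 2) fun x hx => by
    rw [eval_sub, eval_pow, hreval x hx, Real.sq_sqrt (hpos x hx), sub_self]
  have htdeg : t.degree < n := by
    rcases eq_or_ne t 0 with rfl | ht0
    · rw [degree_zero]; exact WithBot.bot_lt_coe n
    have hn : 0 < n := by omega
    have h1 : r.natDegree < n := by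
      rcases eq_or_ne r 0 with h | h
      · rw [h]; simpa using hn
      · exact (natDegree_lt_iff_degree_lt h).2 hrdeg
    have h2 : (q - r ^ 2).natDegree < 2 * n := by
      refine (natDegree_sub_le _ _).trans_lt (max_lt hq ?_)
      rw [natDegree_pow]; omega
    rw [ht, natDegree_mul (hP.monic n).ne_zero ht0, hP.natDegree_eq] at h2
    rw [← natDegree_lt_iff_degree_lt ht0]; omega
  have h3 := hP.integral_mul_eq_zero hμ htdeg
  rw [← ht] at h3
  simp only [eval_sub] at h3
  rw [integral_sub (hμ.integrable_eval _) (hμ.integrable_eval _), sub_eq_zero] at h3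
  rw [h3]
  exact MeasureTheory.integral_nonneg fun x => by rw [eval_pow]; exact sq_nonneg _

lemma le_zero_of_forall_le_mul_pow {c C r : ℝ} (hr0 : 0 ≤ r) (hr : r < 1)
    (h : ∀ k : ℕ, c ≤ C * r ^ k) : c ≤ 0 := by
  have := (tendsto_pow_atTop_nhds_zero_of_lt_one hr0 hr).const_mul C
  rw [mul_zero] at this
  exact ge_of_tendsto' this h

/-- Quadrature applied to `R ^ (2k) - x ^ (2k)` bounds the even moments. Mass beyond `R₁ > R` would
make them grow at least like `R₁ ^ (2k)`. -/
lemma IsMonicOrthogonal.abs_le_of_mem_support {a b : ℕ → ℝ} (hμ : IsNontrivial μ)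
    (hP : IsMonicOrthogonal μ P) (hab : IsJacobiParameters P a b) {R : ℝ} (hR : 0 < R)
    (hroot : ∀ n x, (P n).eval x = 0 → |x| ≤ R) {E : ℝ} (hE : E ∈ μ.support) : |E| ≤ R := by
  have := hμ.isFiniteMeasure
  by_contra hcon
  push Not at hcon
  obtain ⟨R₁, hR1, hR2⟩ := exists_between hcon
  have hR₁ : 0 < R₁ := hR.trans hR1
  set U : Set ℝ := {x | R₁ ≤ |x|} with hU
  have hUpos : 0 < μ.real U := by
    refine ENNReal.toReal_pos ?_ (measure_ne_top _ _)
    refine ((Measure.mem_support_iff_forall E).1 hE U ?_).ne'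
    filter_upwards [(isOpen_lt continuous_const continuous_abs).mem_nhds hR2]
      with x hx using le_of_lt hx
  have hmom : ∀ k : ℕ, ∫ x, x ^ (2 * k) ∂μ ≤ R ^ (2 * k) * μ.real Set.univ := by
    intro k
    have h1 := hP.integral_nonneg hμ hab (n := k + 1) (q := C (R ^ (2 * k)) - X ^ (2 * k))
      (by
        refine (natDegree_sub_le _ _).trans_lt ?_
        rw [natDegree_C, natDegree_X_pow]; simp)
      (fun x hx => by
        simp only [eval_sub, eval_C, eval_pow, eval_X, sub_nonneg]
        rw [← (even_two_mul k).pow_abs]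
        exact pow_le_pow_left₀ (abs_nonneg x) (hroot _ x hx) _)
    simp only [eval_sub, eval_C, eval_pow, eval_X] at h1
    rw [integral_sub (integrable_const _) (hμ.integrable_pow _), integral_const, smul_eq_mul] at h1
    linarith
  refine absurd (le_zero_of_forall_le_mul_pow (c := μ.real U) (C := μ.real Set.univ)
    (r := (R / R₁) ^ 2) (by positivity) ?_ fun k => ?_) (not_le.2 hUpos)
  · rw [div_pow, div_lt_one (by positivity)]
    gcongr
  · have h1 : R₁ ^ (2 * k) * μ.real U ≤ ∫ x, x ^ (2 * k) ∂μ := by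
      have h2 := mul_meas_ge_le_integral_of_nonneg (μ := μ) (f := fun x : ℝ => x ^ (2 * k))
        (Eventually.of_forall fun x => (even_two_mul k).pow_nonneg x) (hμ.integrable_pow _)
        (R₁ ^ (2 * k))
      refine le_trans ?_ h2
      gcongr
      · exact measure_ne_top _ _
      · intro x hx
        have h3 : R₁ ^ (2 * k) ≤ |x| ^ (2 * k) := pow_le_pow_left₀ hR₁.le hx _
        rwa [(even_two_mul k).pow_abs] at h3
    have h2 := h1.trans (hmom k)
    rw [← pow_mul, div_pow, ← mul_div_assoc, le_div_iff₀ (by positivity)]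
    linarith

/-- Every point of the support is a limit of zeros. -/
lemma IsMonicOrthogonal.eventually_exists_root {a b : ℕ → ℝ} (hμ : IsNontrivial μ)
    (hP : IsMonicOrthogonal μ P) (hab : IsJacobiParameters P a b)
    (hsum : Summable fun n : ℕ => (n : ℝ) * (|a n - 1| + |b n|)) {E : ℝ} (hE : E ∈ μ.support)
    {ε : ℝ} (hε : 0 < ε) : ∀ᶠ n in atTop, ∃ x, (P n).eval x = 0 ∧ |x - E| < ε := by
  have := hμ.isFiniteMeasure
  obtain ⟨R, hR, hroot⟩ := hab.exists_abs_root_le hP.zero_eq_one hsum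
  have hsupp : ∀ x ∈ μ.support, |x| ≤ R := fun x hx => hP.abs_le_of_mem_support hμ hab hR hroot hx
  by_contra hcon
  rw [not_eventually] at hcon
  -- Since `(x - E) ^ 2 ≤ 4 * R ^ 2` on the support, this keeps `1 - (x - E) ^ 2 / M` in `[0, 1]`
  -- there.
  set M := 4 * R ^ 2 + ε ^ 2 with hM
  have hM0 : 0 < M := by positivity
  set ρ₁ := 1 - ε ^ 2 / 4 / M with hρ₁
  set ρ₂ := 1 - ε ^ 2 / M with hρ₂
  have hρ₂0 : 0 ≤ ρ₂ := by
    rw [hρ₂, sub_nonneg, div_le_one hM0, hM]; nlinarith [sq_nonneg R]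
  have hρ12 : ρ₂ < ρ₁ := by
    rw [hρ₁, hρ₂]
    have : ε ^ 2 / 4 / M < ε ^ 2 / M := by
      gcongr; nlinarith [sq_pos_of_pos hε]
    linarith
  have hρ₁0 : 0 < ρ₁ := hρ₂0.trans_lt hρ12
  set B : Set ℝ := Metric.ball E (ε / 2) with hB
  have hBpos : 0 < μ.real B := by
    refine ENNReal.toReal_pos ?_ (measure_ne_top _ _)
    exact ((Measure.mem_support_iff_forall E).1 hE B (Metric.ball_mem_nhds E (by positivity))).ne'
  -- The first factor is nonnegative at every zero at distance at least `ε` from `E`; the power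
  -- concentrates weight near `E`, where that factor is negative. The negative part decays like `ρ₁
  -- ^ (2k)` and the positive part at most like `ρ₂ ^ (2k)`, with `ρ₂ < ρ₁`.
  let q : ℕ → ℝ[X] := fun k => ((X - C E) ^ 2 - C (ε ^ 2)) *
    (1 - C (1 / M) * (X - C E) ^ 2) ^ (2 * k)
  have hqeval : ∀ k x, (q k).eval x = ((x - E) ^ 2 - ε ^ 2) * (1 - (x - E) ^ 2 / M) ^ (2 * k) :=
    fun k x => by simp [q]; left; ring
  have hqint : ∀ k, 0 ≤ ∫ x, (q k).eval x ∂μ := by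
    intro k
    obtain ⟨n, hn, hnk⟩ := (hcon.and_eventually (eventually_gt_atTop ((q k).natDegree))).exists
    refine hP.integral_nonneg hμ hab (n := n) (by omega) fun x hx => ?_
    rw [hqeval]
    refine mul_nonneg ?_ ((even_two_mul k).pow_nonneg _)
    push Not at hn
    have := hn x hx
    rw [sub_nonneg, ← sq_abs (x - E)]
    exact pow_le_pow_left₀ hε.le this 2
  have hpt : ∀ k, ∀ x ∈ μ.support, (q k).eval x ≤
      B.indicator (fun _ => -(3 / 4 * ε ^ 2 * ρ₁ ^ (2 * k))) x + M * ρ₂ ^ (2 * k) := by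
    intro k x hx
    rw [hqeval]
    have hxE : (x - E) ^ 2 ≤ 4 * R ^ 2 := by
      have h1 := abs_sub x E
      have h2 := hsupp x hx
      have h3 := hsupp E hE
      rw [← sq_abs (x - E)]
      nlinarith [abs_nonneg (x - E)]
    set v := (x - E) ^ 2 with hv
    have hv0 : 0 ≤ v := sq_nonneg _
    have hu0 : 0 ≤ 1 - v / M := by
      rw [sub_nonneg, div_le_one hM0, hM]; nlinarith [sq_nonneg ε]
    have hT : 0 ≤ M * ρ₂ ^ (2 * k) := by positivity
    by_cases hxB : x ∈ B
    · rw [Set.indicator_of_mem hxB]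
      rw [hB, Metric.mem_ball, Real.dist_eq] at hxB
      have hv4 : v ≤ ε ^ 2 / 4 := by
        rw [hv, ← sq_abs]
        nlinarith [abs_nonneg (x - E)]
      have h1 : ρ₁ ≤ 1 - v / M := by rw [hρ₁]; gcongr
      have h2 : ρ₁ ^ (2 * k) ≤ (1 - v / M) ^ (2 * k) := pow_le_pow_left₀ hρ₁0.le h1 _
      have h3 := mul_le_mul (by linarith : 3 / 4 * ε ^ 2 ≤ ε ^ 2 - v) h2 (by positivity)
        (by nlinarith [sq_nonneg ε])
      linarith
    · rw [Set.indicator_of_notMem hxB, zero_add]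
      rcases le_total v (ε ^ 2) with h | h
      · exact (mul_nonpos_of_nonpos_of_nonneg (by linarith) (pow_nonneg hu0 _)).trans hT
      · have h1 : 1 - v / M ≤ ρ₂ := by rw [hρ₂]; gcongr
        exact mul_le_mul (by rw [hM]; nlinarith [sq_nonneg ε]) (pow_le_pow_left₀ hu0 h1 _)
          (pow_nonneg hu0 _) hM0.le
  refine absurd (le_zero_of_forall_le_mul_pow (c := 3 / 4 * ε ^ 2 * μ.real B)
    (C := M * μ.real Set.univ)
    (r := (ρ₂ / ρ₁) ^ 2) (by positivity) ?_ fun k => ?_) (not_le.2 (by positivity))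
  · rw [div_pow, div_lt_one (by positivity)]
    gcongr
  · have hmeas : MeasurableSet B := Metric.isOpen_ball.measurableSet
    have h1 := integral_mono_ae (hμ.integrable_eval (q k))
      (((integrable_const (-(3 / 4 * ε ^ 2 * ρ₁ ^ (2 * k)))).indicator hmeas).add
        (integrable_const (M * ρ₂ ^ (2 * k))))
      (by filter_upwards [Measure.support_mem_ae (μ := μ)] with x hx using hpt k x hx)
    simp only [Pi.add_apply] at h1
    rw [integral_add ((integrable_const _).indicator hmeas) (integrable_const _),
      integral_indicator hmeas, setIntegral_const, integral_const, smul_eq_mul, smul_eq_mul] at h1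
    have h2 := (hqint k).trans h1
    rw [← pow_mul, div_pow, ← mul_div_assoc, le_div_iff₀ (by positivity)]
    linarith

end Measure

/-! ### Transfer between the two band edges. -/

section Reflection

variable {P : ℕ → ℝ[X]} {a b : ℕ → ℝ}

/-- The orthogonal polynomials `(-1) ^ n P_n(-x)` of the reflected measure. -/
noncomputable def reflected (P : ℕ → ℝ[X]) (n : ℕ) : ℝ[X] := C ((-1) ^ n) * (P n).comp (-X)

lemma eval_reflected_eq_zero_iff {n : ℕ} {x : ℝ} :
    (reflected P n).eval x = 0 ↔ (P n).eval (-x) = 0 := by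
  simp [reflected]

lemma IsJacobiParameters.reflected (hab : IsJacobiParameters P a b) :
    IsJacobiParameters (reflected P) a (fun n => -b n) where
  a_pos := hab.a_pos
  recursion_zero := by
    have h := congrArg (fun p : ℝ[X] => p.comp (-X)) hab.recursion_zero
    simp only [mul_comp, add_comp, X_comp, C_comp] at h
    simp only [OPRL.reflected, pow_zero, pow_one, C_neg, C_1]
    linear_combination -h
  recursion := by
    intro n hn
    obtain ⟨m, rfl⟩ := Nat.exists_eq_add_of_le' hn
    have h := congrArg (fun p : ℝ[X] => p.comp (-X)) (hab.recursion (m + 1) hn)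
    simp only [mul_comp, add_comp, X_comp, C_comp, Nat.add_sub_cancel] at h
    simp only [OPRL.reflected, Nat.add_sub_cancel, pow_succ (-1 : ℝ), mul_neg, mul_one, neg_neg,
      C_neg]
    linear_combination (C ((-1 : ℝ) ^ m)) * h

lemma reflected_zero (h0 : P 0 = 1) : reflected P 0 = 1 := by
  simp [reflected, h0]

lemma summable_reflected (hsum : Summable fun n : ℕ => (n : ℝ) * (|a n - 1| + |b n|)) :
    Summable fun n : ℕ => (n : ℝ) * (|a n - 1| + |-b n|) := by
  simpa only [abs_neg] using hsum

/-- Asymptotically equal spacing of consecutive zero angles. -/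
lemma IsJacobiParameters.eventually_spacing (hab : IsJacobiParameters P a b)
    (h0 : P 0 = 1) (hsum : Summable fun n : ℕ => (n : ℝ) * (|a n - 1| + |b n|))
    {κ : ℝ} (hκ : 0 < κ) :
    ∀ᶠ n : ℕ in atTop, ∀ θ ∈ zeroAngles (P n), ∀ t ∈ zeroAngles (P n), θ < t →
      (∀ u ∈ Set.Ioo θ t, u ∉ zeroAngles (P n)) → |n * (t - θ) - Real.pi| ≤ κ := by
  have hmem : ∀ n u, Real.pi - u ∈ zeroAngles (OPRL.reflected P n) ↔ u ∈ zeroAngles (P n) := by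
    intro n u
    simp only [zeroAngles, Set.mem_ofPred_eq, eval_reflected_eq_zero_iff, Real.cos_pi_sub,
      mul_neg, neg_neg, Set.mem_Ioo]
    refine and_congr_left fun _ => ⟨fun h => ⟨by linarith [h.2], by linarith [h.1]⟩,
      fun h => ⟨by linarith [h.2], by linarith [h.1]⟩⟩
  filter_upwards [hab.eventually_spacing_right h0 hsum hκ,
    hab.reflected.eventually_spacing_right (reflected_zero h0) (summable_reflected hsum) hκ]
    with n h1 h2 θ hθ t ht hlt hnone
  rcases le_total θ (Real.pi / 2) with h | h
  · exact h1 θ hθ h t ht hlt hnone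
  · have := h2 (Real.pi - t) ((hmem n t).2 ht) (by linarith) (Real.pi - θ) ((hmem n θ).2 hθ)
      (by linarith) fun u hu hz => by
        rw [← sub_sub_cancel Real.pi u, hmem] at hz
        exact hnone _ ⟨by linarith [hu.2], by linarith [hu.1]⟩ hz
    rwa [sub_sub_sub_cancel_left] at this

/-- Zero angles range over the open interval, so zeros at `±2` would escape the parametrization. -/
lemma IsJacobiParameters.eventually_eval_two_ne_zero (hab : IsJacobiParameters P a b)
    (h0 : P 0 = 1) (hsum : Summable fun n : ℕ => (n : ℝ) * (|a n - 1| + |b n|)) :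
    ∀ᶠ n : ℕ in atTop, (P n).eval 2 ≠ 0 ∧ (P n).eval (-2) ≠ 0 := by
  filter_upwards [hab.eventually_eval_two_mul_pos h0 hsum,
    hab.reflected.eventually_eval_two_mul_pos (reflected_zero h0) (summable_reflected hsum)]
    with n h1 h2
  exact ⟨left_ne_zero_of_mul h1.ne', fun h => left_ne_zero_of_mul h2.ne'
    (eval_reflected_eq_zero_iff.2 h)⟩

lemma IsJacobiParameters.exists_ncard_zerosOutside_le (hab : IsJacobiParameters P a b)
    (h0 : P 0 = 1) (hsum : Summable fun n : ℕ => (n : ℝ) * (|a n - 1| + |b n|)) :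
    ∃ K, ∀ᶠ n : ℕ in atTop, (zerosOutside (P n)).ncard ≤ K := by
  obtain ⟨K₁, h1⟩ := hab.exists_ncard_rootsAbove_le h0 hsum
  obtain ⟨K₂, h2⟩ := hab.reflected.exists_ncard_rootsAbove_le (reflected_zero h0)
    (summable_reflected hsum)
  refine ⟨K₁ + K₂, ?_⟩
  filter_upwards [h1, h2] with n hn1 hn2
  have hf1 := finite_rootsAbove (hab.ne_zero h0 n)
  have hf2 := finite_rootsAbove (hab.reflected.ne_zero (reflected_zero h0) n)
  have hsub : zerosOutside (P n) ⊆
      rootsAbove (P n) ∪ (fun x => -x) '' rootsAbove (OPRL.reflected P n) := by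
    rintro x ⟨hx, hx2⟩
    rw [Set.mem_Icc, not_and_or, not_le, not_le] at hx2
    rcases hx2 with h | h
    · refine Or.inr ⟨-x, ⟨eval_reflected_eq_zero_iff.2 ?_, by linarith⟩, neg_neg x⟩
      rw [neg_neg]; exact hx
    · exact Or.inl ⟨hx, h⟩
  calc _ ≤ _ := Set.ncard_le_ncard hsub (hf1.union (hf2.image _))
    _ ≤ _ := Set.ncard_union_le _ _
    _ ≤ K₁ + K₂ := add_le_add hn1 ((Set.ncard_image_le hf2).trans hn2)

end Reflection

/-! ### Zeros and mass points outside the band. -/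

section Counting

variable {μ : Measure ℝ} {P : ℕ → ℝ[X]} {a b : ℕ → ℝ}

lemma finite_zerosOutside {p : ℝ[X]} (hp : p ≠ 0) : (zerosOutside p).Finite :=
  (finite_setOfPred_isRoot hp).subset fun _ hx => hx.1

lemma IsMonicOrthogonal.ncard_zerosInside_add (hμ : IsNontrivial μ) (hP : IsMonicOrthogonal μ P)
    (hab : IsJacobiParameters P a b) (n : ℕ) :
    (zerosInside (P n)).ncard + (zerosOutside (P n)).ncard = n := by
  classical
  have hne := (hP.monic n).ne_zero
  have hfin := finite_setOfPred_isRoot hne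
  rw [← Set.ncard_union_eq (Set.disjoint_left.2 fun x hx hx' => hx'.2 hx.2)
    (hfin.subset fun _ hx => hx.1) (finite_zerosOutside hne)]
  have h1 : zerosInside (P n) ∪ zerosOutside (P n) = ((P n).roots.toFinset : Set ℝ) := by
    ext x
    simp only [zerosInside, zerosOutside, Set.mem_union, Set.mem_ofPred_eq, Finset.mem_coe,
      Multiset.mem_toFinset, mem_roots hne]
    tauto
  rw [h1, Set.ncard_coe_finset, Multiset.toFinset_card_of_nodup (hP.nodup_roots hab n),
    hP.card_roots hμ]

/-- No factor `x - e` changes sign on `[-2, 2]`, so its value at `x = 0` serves as its sign. -/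
lemma eval_prod_mul_prod_neg_nonneg {T : Finset ℝ} (hT : ∀ e ∈ T, e ∉ Set.Icc (-2 : ℝ) 2) {x : ℝ}
    (hx : x ∈ Set.Icc (-2 : ℝ) 2) : 0 ≤ (∏ e ∈ T, (x - e)) * ∏ e ∈ T, -e := by
  rw [← Finset.prod_mul_distrib]
  refine Finset.prod_nonneg fun e he => ?_
  have h := hT e he
  rw [Set.mem_Icc, not_and_or, not_le, not_le] at h
  rcases h with h | h
  · exact mul_nonneg (by linarith [hx.1]) (by linarith)
  · exact mul_nonneg_of_nonpos_of_nonpos (by linarith [hx.2]) (by linarith)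

/-- There are at most as many zeros outside `[-2, 2]` as points of the support. -/
lemma IsMonicOrthogonal.ncard_zerosOutside_le (hμ : IsNontrivial μ) (hP : IsMonicOrthogonal μ P)
    (hfin : (μ.support \ Set.Icc (-2) 2).Finite) (n : ℕ) :
    (zerosOutside (P n)).ncard ≤ (μ.support \ Set.Icc (-2) 2).ncard := by
  classical
  have hne := (hP.monic n).ne_zero
  have hKfin := finite_zerosOutside hne
  by_contra hcon
  push Not at hcon
  set K := hKfin.toFinset with hK
  set S := hfin.toFinset with hS
  rw [Set.ncard_eq_toFinset_card _ hKfin, Set.ncard_eq_toFinset_card _ hfin, ← hK, ← hS] at hcon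
  have hKmem : ∀ x, x ∈ K ↔ (P n).eval x = 0 ∧ x ∉ Set.Icc (-2 : ℝ) 2 := fun x => by
    simp [hK, zerosOutside]
  have hSmem : ∀ x, x ∈ S ↔ x ∈ μ.support ∧ x ∉ Set.Icc (-2 : ℝ) 2 := fun x => by
    simp [hS]
  have hdvd : (∏ e ∈ K, (X - C e)) ∣ P n := by
    have h1 : K.val ≤ (P n).roots := by
      rw [Multiset.le_iff_subset K.nodup]
      intro x hx
      exact (mem_roots hne).2 ((hKmem x).1 hx).1
    exact (Multiset.prod_X_sub_C_dvd_iff_le_roots hne K.val).2 h1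
  obtain ⟨g, hg⟩ := hdvd
  have hAK : ∀ T : Finset ℝ, (∏ e ∈ T, (X - C e)).Monic := fun T =>
    monic_prod_of_monic _ _ fun e _ => monic_X_sub_C e
  have hAdeg : ∀ T : Finset ℝ, (∏ e ∈ T, (X - C e)).natDegree = T.card := fun T => by
    rw [natDegree_prod_of_monic _ _ fun e _ => monic_X_sub_C e]; simp
  have hg0 : g ≠ 0 := by
    rintro rfl
    exact hne (by rw [hg, mul_zero])
  have hgdeg : K.card + g.natDegree = n := by
    rw [← hP.natDegree_eq n, hg, natDegree_mul (hAK K).ne_zero hg0, hAdeg]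
  set c : ℝ := (∏ e ∈ K, -e) * ∏ e ∈ S, -e with hc
  have hprod0 : ∀ T : Finset ℝ, (∀ e ∈ T, e ∉ Set.Icc (-2 : ℝ) 2) → ∏ e ∈ T, -e ≠ 0 := by
    intro T hT
    refine Finset.prod_ne_zero_iff.2 fun e he h => hT e he ?_
    rw [neg_eq_zero] at h
    rw [h]; constructor <;> norm_num
  have hKout : ∀ e ∈ K, e ∉ Set.Icc (-2 : ℝ) 2 := fun e he => ((hKmem e).1 he).2
  have hSout : ∀ e ∈ S, e ∉ Set.Icc (-2 : ℝ) 2 := fun e he => ((hSmem e).1 he).2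
  have hc0 : c ≠ 0 := mul_ne_zero (hprod0 K hKout) (hprod0 S hSout)
  -- Replacing the outside zeros by the fewer outside support points lowers the degree below `n`.
  -- With the sign `c`, `P n * r` is nonnegative on the band and zero at the other support points,
  -- contradicting orthogonality.
  set r := C c * (g * ∏ e ∈ S, (X - C e)) with hr
  have hgS : g * ∏ e ∈ S, (X - C e) ≠ 0 := mul_ne_zero hg0 (hAK S).ne_zero
  have hrdeg : r.degree < n := by
    rw [hr, degree_C_mul hc0, degree_eq_natDegree hgS, natDegree_mul hg0 (hAK S).ne_zero, hAdeg]
    exact_mod_cast (by omega : g.natDegree + S.card < n)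
  have hz := hμ.eq_zero_of_integral_eq_zero (fun x hx => ?_) (hP.integral_mul_eq_zero hμ hrdeg)
  · exact mul_ne_zero hne (mul_ne_zero (by simpa using hc0) hgS) hz
  · have he : (P n * r).eval x = g.eval x ^ 2 * (((∏ e ∈ K, (x - e)) * ∏ e ∈ K, -e) *
        ((∏ e ∈ S, (x - e)) * ∏ e ∈ S, -e)) := by
      rw [hr, hg, hc]
      simp only [eval_mul, eval_C, eval_prod, eval_sub, eval_X]
      ring
    rw [he]
    refine mul_nonneg (sq_nonneg _) ?_
    by_cases hxI : x ∈ Set.Icc (-2 : ℝ) 2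
    · exact mul_nonneg (eval_prod_mul_prod_neg_nonneg hKout hxI)
        (eval_prod_mul_prod_neg_nonneg hSout hxI)
    · rw [Finset.prod_eq_zero ((hSmem x).2 ⟨hx, hxI⟩) (sub_self x)]
      simp

/-- Eventually there are at least as many zeros outside `[-2, 2]` as points of the support. -/
lemma IsMonicOrthogonal.eventually_card_le_ncard_zerosOutside (hμ : IsNontrivial μ)
    (hP : IsMonicOrthogonal μ P) (hab : IsJacobiParameters P a b)
    (hsum : Summable fun n : ℕ => (n : ℝ) * (|a n - 1| + |b n|)) {T : Finset ℝ}
    (hT : (T : Set ℝ) ⊆ μ.support \ Set.Icc (-2) 2) :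
    ∀ᶠ n in atTop, T.card ≤ (zerosOutside (P n)).ncard := by
  obtain ⟨U, hU, hdisj⟩ := T.finite_toSet.t2_separation
  have hex : ∀ E ∈ T, ∀ᶠ n in atTop, ∃ x, (P n).eval x = 0 ∧ x ∈ U E ∩ (Set.Icc (-2) 2)ᶜ := by
    intro E hE
    have hopen : IsOpen (U E ∩ (Set.Icc (-2 : ℝ) 2)ᶜ) := (hU E).2.inter isClosed_Icc.isOpen_compl
    obtain ⟨ε, hε, hball⟩ := Metric.isOpen_iff.1 hopen E ⟨(hU E).1, (hT hE).2⟩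
    filter_upwards [hP.eventually_exists_root hμ hab hsum (hT hE).1 hε] with n ⟨x, hx, hxE⟩
    exact ⟨x, hx, hball (by rwa [Metric.mem_ball, Real.dist_eq])⟩
  filter_upwards [(Filter.eventually_all_finset T).2 hex] with n hn
  choose! f hf using hn
  rw [← Set.ncard_coe_finset]
  refine Set.ncard_le_ncard_of_injOn f (fun E hE => ⟨(hf E hE).1, (hf E hE).2.2⟩) ?_
    (finite_zerosOutside (hP.monic n).ne_zero)
  intro E hE E' hE' he
  by_contra hne
  exact Set.disjoint_left.1 (hdisj hE hE' hne) (hf E hE).2.1 (he ▸ (hf E' hE').2.1)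

/-- Finiteness isolates each support point outside the band, so all the mass of a small
neighbourhood sits at that point. -/
lemma massPointsOutside_eq (hfin : (μ.support \ Set.Icc (-2) 2).Finite) :
    massPointsOutside μ = μ.support \ Set.Icc (-2) 2 := by
  ext E
  constructor
  · rintro ⟨hE, hμE⟩
    refine ⟨(Measure.mem_support_iff_forall E).2 fun U hU => ?_, hE⟩
    exact (pos_iff_ne_zero.2 hμE).trans_le
      (measure_mono (Set.singleton_subset_iff.2 (mem_of_mem_nhds hU)))
  · rintro ⟨hE, hE2⟩
    refine ⟨hE2, fun h0 => ?_⟩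
    set V : Set ℝ := (Set.Icc (-2 : ℝ) 2)ᶜ ∩ ((μ.support \ Set.Icc (-2) 2) \ {E})ᶜ with hV
    have hVopen : IsOpen V :=
      isClosed_Icc.isOpen_compl.inter (hfin.subset Set.sdiff_subset).isClosed.isOpen_compl
    have hEV : E ∈ V := ⟨hE2, fun h => h.2 rfl⟩
    have h1 := (Measure.mem_support_iff_forall E).1 hE V (hVopen.mem_nhds hEV)
    have h2 : V ⊆ {E} ∪ μ.supportᶜ := by
      rintro x ⟨hx1, hx2⟩
      by_cases hx : x ∈ μ.support
      · left
        by_contra hne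
        exact hx2 ⟨⟨hx, hx1⟩, hne⟩
      · exact Or.inr hx
    have h3 : μ V ≤ 0 := by
      refine (measure_mono h2).trans ((measure_union_le _ _).trans ?_)
      rw [h0, Measure.measure_compl_support, add_zero]
    exact absurd h1 (not_lt.2 h3)

end Counting

/-! ### Ordering the zero angles. -/

section Angles

lemma zeroAngles_injOn (p : ℝ[X]) : Set.InjOn (fun θ => 2 * Real.cos θ) (zeroAngles p) := by
  intro θ hθ t ht h
  exact Real.injOn_cos ⟨hθ.1.1.le, hθ.1.2.le⟩ ⟨ht.1.1.le, ht.1.2.le⟩ (by simpa using h)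

lemma finite_zeroAngles {p : ℝ[X]} (hp : p ≠ 0) : (zeroAngles p).Finite :=
  Set.Finite.of_finite_image ((finite_setOfPred_isRoot hp).subset
    (Set.image_subset_iff.2 fun _ hθ => hθ.2)) (zeroAngles_injOn p)

lemma image_zeroAngles {p : ℝ[X]} (h1 : p.eval 2 ≠ 0) (h2 : p.eval (-2) ≠ 0) :
    (fun θ => 2 * Real.cos θ) '' zeroAngles p = zerosInside p := by
  ext x
  constructor
  · rintro ⟨θ, hθ, rfl⟩
    refine ⟨hθ.2, ?_, ?_⟩
    · linarith [Real.neg_one_le_cos θ]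
    · linarith [Real.cos_le_one θ]
  · rintro ⟨hx, hx1, hx2⟩
    have hlt1 : -2 < x := lt_of_le_of_ne hx1 fun h => h2 (h ▸ hx)
    have hlt2 : x < 2 := lt_of_le_of_ne hx2 fun h => h1 (h ▸ hx)
    have hc : 2 * Real.cos (Real.arccos (x / 2)) = x := by
      rw [Real.cos_arccos (by linarith) (by linarith)]; ring
    refine ⟨Real.arccos (x / 2), ⟨⟨Real.arccos_pos.2 (by linarith), ?_⟩, by rw [hc]; exact hx⟩, hc⟩
    exact lt_of_le_of_ne (Real.arccos_le_pi _) fun h => by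
      rw [Real.arccos_eq_pi] at h; linarith

lemma exists_strictMonoOn_enumeration {A : Set ℝ} (hA : A.Finite) :
    ∃ f : ℕ → ℝ, StrictMonoOn f (Set.Icc 1 A.ncard) ∧ f '' Set.Icc 1 A.ncard = A := by
  have hcard : hA.toFinset.card = A.ncard := (Set.ncard_eq_toFinset_card A hA).symm
  set e := hA.toFinset.orderEmbOfFin hcard with he
  have hr : Set.range e = A := by rw [he, Finset.range_orderEmbOfFin, hA.coe_toFinset]
  -- The shift starts the enumeration at 1; the default 0 only occurs outside `Set.Icc 1 A.ncard`.
  refine ⟨fun j => if h : j - 1 < A.ncard then e ⟨j - 1, h⟩ else 0, ?_, ?_⟩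
  · intro i hi j hj hij
    simp only [Set.mem_Icc] at hi hj
    simp only
    rw [dif_pos (by omega), dif_pos (by omega)]
    exact e.strictMono (by rw [Fin.lt_def]; simp only; omega)
  · refine Eq.trans ?_ hr
    ext x
    constructor
    · rintro ⟨j, hj, rfl⟩
      simp only [Set.mem_Icc] at hj
      simp only
      rw [dif_pos (by omega)]
      exact ⟨_, rfl⟩
    · rintro ⟨i, rfl⟩
      refine ⟨i + 1, ⟨by omega, i.2⟩, ?_⟩
      simp

end Angles

end OPRL

/-! ### Assembly. -/

theorem theorem4p2 (μ : Measure ℝ) (hμ : OPRL.IsNontrivial μ)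
    (P : ℕ → ℝ[X]) (hP : OPRL.IsMonicOrthogonal μ P)
    (a b : ℕ → ℝ) (hab : OPRL.IsJacobiParameters P a b)
    (hsum : Summable fun n : ℕ => (n : ℝ) * (|a n - 1| + |b n|)) :
    (OPRL.massPointsOutside μ).Finite ∧
    (∀ᶠ n : ℕ in atTop,
      (OPRL.zerosOutside (P n)).ncard = OPRL.massPointCount μ ∧
      (OPRL.zerosInside (P n)).ncard + OPRL.massPointCount μ = n) ∧
    ∃ θ : ℕ → ℕ → ℝ,
      (∀ᶠ n : ℕ in atTop,
        (∀ j ∈ Set.Icc 1 (n - OPRL.massPointCount μ), θ n j ∈ Set.Ioo 0 Real.pi) ∧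
        StrictMonoOn (θ n) (Set.Icc 1 (n - OPRL.massPointCount μ)) ∧
        OPRL.zerosInside (P n) =
          (fun j => 2 * Real.cos (θ n j)) '' Set.Icc 1 (n - OPRL.massPointCount μ)) ∧
      Tendsto
        (fun n : ℕ => ⨆ j : Set.Icc 1 (n - OPRL.massPointCount μ - 1),
          (n : ℝ) * |θ n (j + 1) - θ n j - 2 * Real.pi / (2 * n)|)
        atTop (𝓝 0) := by
  have h0 := hP.zero_eq_one
  obtain ⟨K, hK⟩ := hab.exists_ncard_zerosOutside_le h0 hsum
  -- Any `K + 1` support points outside the band would eventually attract `K + 1` distinct outside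
  -- zeros.
  have hfin : (μ.support \ Set.Icc (-2) 2).Finite := by
    by_contra hinf
    obtain ⟨T, hT, hcard⟩ := Set.Infinite.exists_subset_card_eq hinf (K + 1)
    obtain ⟨n, h1, h2⟩ :=
      (hK.and (hP.eventually_card_le_ncard_zerosOutside hμ hab hsum hT)).exists
    omega
  have hmass := OPRL.massPointsOutside_eq hfin
  have hout : ∀ᶠ n : ℕ in atTop, (OPRL.zerosOutside (P n)).ncard = OPRL.massPointCount μ := by
    filter_upwards [hP.eventually_card_le_ncard_zerosOutside hμ hab hsum (T := hfin.toFinset)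
      (by simp)] with n hn
    rw [← Set.ncard_eq_toFinset_card _ hfin] at hn
    rw [OPRL.massPointCount, hmass]
    exact le_antisymm (hP.ncard_zerosOutside_le hμ hfin n) hn
  have hcount : ∀ᶠ n : ℕ in atTop,
      (OPRL.zerosOutside (P n)).ncard = OPRL.massPointCount μ ∧
      (OPRL.zerosInside (P n)).ncard + OPRL.massPointCount μ = n := by
    filter_upwards [hout] with n hn
    exact ⟨hn, hn ▸ hP.ncard_zerosInside_add hμ hab n⟩
  choose θ hθmono hθimage using fun n =>
    OPRL.exists_strictMonoOn_enumeration (OPRL.finite_zeroAngles (hP.monic n).ne_zero)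
  have hcard : ∀ᶠ n : ℕ in atTop,
      (OPRL.zeroAngles (P n)).ncard = n - OPRL.massPointCount μ := by
    filter_upwards [hcount, hab.eventually_eval_two_ne_zero h0 hsum] with n h1 h2
    rw [← (OPRL.zeroAngles_injOn (P n)).ncard_image, OPRL.image_zeroAngles h2.1 h2.2]
    omega
  refine ⟨hmass ▸ hfin, hcount, θ, ?_, ?_⟩
  · filter_upwards [hcard, hab.eventually_eval_two_ne_zero h0 hsum] with n h1 h2
    have hm := hθmono n
    have hi := hθimage n
    rw [h1] at hm hi
    refine ⟨fun j hj => ?_, hm, ?_⟩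
    · have : θ n j ∈ OPRL.zeroAngles (P n) := hi ▸ Set.mem_image_of_mem _ hj
      exact this.1
    · rw [← OPRL.image_zeroAngles h2.1 h2.2, ← hi, Set.image_image]
  · rw [Metric.tendsto_nhds]
    intro ε hε
    filter_upwards [hcard, hab.eventually_spacing h0 hsum (half_pos hε), eventually_gt_atTop 0]
      with n h1 hspace hn0
    have hn : (0 : ℝ) < n := by exact_mod_cast hn0
    have hm := hθmono n
    have hi := hθimage n
    rw [h1] at hm hi
    have hle : ⨆ j : Set.Icc 1 (n - OPRL.massPointCount μ - 1),
        (n : ℝ) * |θ n (j + 1) - θ n j - 2 * Real.pi / (2 * n)| ≤ ε / 2 := by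
      -- Nonnegativity of the bound covers an empty index set, where the real supremum is 0.
      refine Real.iSup_le (fun ⟨j, hj⟩ => ?_) (half_pos hε).le
      rw [Set.mem_Icc] at hj
      have hj1 : j ∈ Set.Icc 1 (n - OPRL.massPointCount μ) := ⟨by omega, by omega⟩
      have hj2 : j + 1 ∈ Set.Icc 1 (n - OPRL.massPointCount μ) := ⟨by omega, by omega⟩
      have hs := hspace (θ n j) (hi ▸ Set.mem_image_of_mem _ hj1) (θ n (j + 1))
        (hi ▸ Set.mem_image_of_mem _ hj2) (hm hj1 hj2 (by omega)) fun u hu hz => by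
          rw [← hi] at hz
          obtain ⟨i, hi', rfl⟩ := hz
          have e1 := (hm.lt_iff_lt hj1 hi').1 hu.1
          have e2 := (hm.lt_iff_lt hi' hj2).1 hu.2
          omega
      refine le_trans (le_of_eq ?_) hs
      nth_rewrite 1 [← abs_of_pos hn]
      rw [← abs_mul]
      congr 1
      field_simp
    have hge : 0 ≤ ⨆ j : Set.Icc 1 (n - OPRL.massPointCount μ - 1),
        (n : ℝ) * |θ n (j + 1) - θ n j - 2 * Real.pi / (2 * n)| :=
      Real.iSup_nonneg fun _ => by positivity
    rw [Real.dist_eq, sub_zero, abs_of_nonneg hge]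
    linarith
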